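/- Let $G$ be a finite group and let $\mathcal{C}$ be a conjugacy class of $G$. Suppose that for all $x_1,\dots,x_{10}\in\mathcal{C}$ (not necessarily distinct) the subgroup $\langle x_1,\dots,x_{10}\rangle$ is solvable. Then the subgroup $\langle\mathcal{C}\rangle$ generated by $\mathcal{C}$ is solvable. -/

import Mathlib

/-! By induction on |G|, it suffices to find a nontrivial normal r-subgroup when x ≠ 1, and then to
pass to the quotient. Complexity is measured by the lower Fitting series, obtained by iterating the
nilpotent residual. Let k + 1 be the largest lower Fitting length of a subgroup generated by ten
conjugates of x, and let r divide the order of the k-th term for a tuple attaining it. By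
`fiveGeneratorProperty`, five conjugates d i already generate a subgroup whose k-th term contains an
element y of order r. For every g, the d i and their g-conjugates are ten conjugates of x, so the
k-th term of the group they generate is nilpotent; it contains y and its g-conjugate, which
therefore generate an r-group. Baer–Suzuki makes the normal closure of y an r-group.

The five-generator statement is proved by induction on k. In a counterexample of least order, the
(k+1)-th term N is a minimal normal abelian r-subgroup, on which the k-th term acts with order
divisible by some prime q ≠ r. Induction for q in the image of G in Aut N gives five elements
generating a group R whose k-th term has a nontrivial Sylow q-subgroup Q; lift them to x i. Choose
an irreducible R-submodule U of N without nontrivial Q-fixed points. If no choice of conjugates of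
the x i worked, Sylow's theorem would make every tuple of U-conjugates of the x i conjugate to x by
a single element of U. Hence |U|^5 is at most |U| times the product of the five fixed-point counts,
each at most |U|^(3/4), which is impossible.

The exponent 3/4 (`card_fixedSubgroup_pow_four_le`) comes from passing from x to a commutator [x,
u], whose fixed points number at most |U|^(1/2). -/

namespace Subgroup

/-! ### The lower Fitting series -/

variable {G G' : Type*} [Group G] [Group G']

/-- The nilpotent residual of a subgroup: the intersection of its lower central series. -/
def nilpotentResidual (H : Subgroup G) : Subgroup G := ⨅ n, H.lowerCentralSeries n

/-- The iterated nilpotent residuals (the lower Fitting series) of a subgroup. -/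
def lowerFittingSeries (H : Subgroup G) : ℕ → Subgroup G
  | 0 => H
  | k + 1 => (lowerFittingSeries H k).nilpotentResidual

@[simp] theorem lowerFittingSeries_zero (H : Subgroup G) : H.lowerFittingSeries 0 = H := rfl

theorem lowerFittingSeries_succ (H : Subgroup G) (k : ℕ) :
    H.lowerFittingSeries (k + 1) = (H.lowerFittingSeries k).nilpotentResidual := rfl

theorem nilpotentResidual_le_lowerCentralSeries (H : Subgroup G) (n : ℕ) :
    H.nilpotentResidual ≤ H.lowerCentralSeries n := iInf_le _ n

theorem nilpotentResidual_le (H : Subgroup G) : H.nilpotentResidual ≤ H :=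
  H.nilpotentResidual_le_lowerCentralSeries 0

theorem nilpotentResidual_mono {H K : Subgroup G} (h : H ≤ K) :
    H.nilpotentResidual ≤ K.nilpotentResidual :=
  iInf_mono fun n => lowerCentralSeries_mono n h

theorem exists_lowerCentralSeries_eq_nilpotentResidual [Finite G] (H : Subgroup G) :
    ∃ N, ∀ n, N ≤ n → H.lowerCentralSeries n = H.nilpotentResidual := by
  obtain ⟨N, hN⟩ := wellFoundedGT_iff_monotone_chain_condition.1 inferInstance
    (⟨fun n => OrderDual.toDual (H.lowerCentralSeries n), fun _ _ h =>
      H.lowerCentralSeries_antitone h⟩ : ℕ →o (Subgroup G)ᵒᵈ)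
  have hN' : ∀ n, N ≤ n → H.lowerCentralSeries N = H.lowerCentralSeries n :=
    fun n hn => OrderDual.toDual.injective (hN n hn)
  refine ⟨N, fun n hn => le_antisymm (le_iInf fun m => ?_)
    (H.nilpotentResidual_le_lowerCentralSeries n)⟩
  rw [← hN' n hn, hN' (max N m) (le_max_left _ _)]
  exact H.lowerCentralSeries_antitone (le_max_right _ _)

/-- The lower central series stabilises at the residual. This later rules out that a term of the
lower Fitting series centralises a nontrivial next term. -/
theorem commutator_nilpotentResidual [Finite G] (H : Subgroup G) :
    ⁅H.nilpotentResidual, H⁆ = H.nilpotentResidual := by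
  obtain ⟨N, hN⟩ := H.exists_lowerCentralSeries_eq_nilpotentResidual
  conv_lhs => rw [← hN N le_rfl]
  rw [← lowerCentralSeries_succ, hN _ (Nat.le_succ N)]

theorem nilpotentResidual_eq_bot_iff [Finite G] (H : Subgroup G) :
    H.nilpotentResidual = ⊥ ↔ Group.IsNilpotent H := by
  rw [isNilpotent_iff_lowerCentralSeries]
  constructor
  · intro h
    obtain ⟨N, hN⟩ := H.exists_lowerCentralSeries_eq_nilpotentResidual
    exact ⟨N, (hN N le_rfl).trans h⟩
  · rintro ⟨n, hn⟩
    exact le_bot_iff.1 (hn ▸ H.nilpotentResidual_le_lowerCentralSeries n)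

theorem map_nilpotentResidual [Finite G] [Finite G'] (f : G →* G') (H : Subgroup G) :
    H.nilpotentResidual.map f = (H.map f).nilpotentResidual := by
  obtain ⟨N, hN⟩ := H.exists_lowerCentralSeries_eq_nilpotentResidual
  obtain ⟨N', hN'⟩ := (H.map f).exists_lowerCentralSeries_eq_nilpotentResidual
  rw [← hN (max N N') (le_max_left _ _), map_lowerCentralSeries, hN' _ (le_max_right _ _)]

instance nilpotentResidual_normal (H : Subgroup G) [H.Normal] : H.nilpotentResidual.Normal :=
  normal_iInf_normal fun n => lowerCentralSeries_normal H n

theorem lowerFittingSeries_mono {H K : Subgroup G} (h : H ≤ K) (k : ℕ) :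
    H.lowerFittingSeries k ≤ K.lowerFittingSeries k := by
  induction k with
  | zero => exact h
  | succ k ih => exact nilpotentResidual_mono ih

theorem lowerFittingSeries_succ_le (H : Subgroup G) (k : ℕ) :
    H.lowerFittingSeries (k + 1) ≤ H.lowerFittingSeries k := nilpotentResidual_le _

theorem lowerFittingSeries_antitone (H : Subgroup G) : Antitone H.lowerFittingSeries :=
  antitone_nat_of_succ_le H.lowerFittingSeries_succ_le

theorem lowerFittingSeries_le (H : Subgroup G) (k : ℕ) : H.lowerFittingSeries k ≤ H :=
  H.lowerFittingSeries_antitone (Nat.zero_le k)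

theorem map_lowerFittingSeries [Finite G] [Finite G'] (f : G →* G') (H : Subgroup G) (k : ℕ) :
    (H.lowerFittingSeries k).map f = (H.map f).lowerFittingSeries k := by
  induction k with
  | zero => rfl
  | succ k ih => rw [lowerFittingSeries_succ, map_nilpotentResidual, ih]; rfl

instance lowerFittingSeries_normal (H : Subgroup G) [H.Normal] (k : ℕ) :
    (H.lowerFittingSeries k).Normal := by
  induction k with
  | zero => simpa
  | succ k _ => rw [lowerFittingSeries_succ]; infer_instance

theorem map_subtype_lowerFittingSeries_top [Finite G] (H : Subgroup G) (k : ℕ) :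
    ((⊤ : Subgroup H).lowerFittingSeries k).map H.subtype = H.lowerFittingSeries k := by
  rw [map_lowerFittingSeries, ← MonoidHom.range_eq_map, range_subtype]

/-- Conjugation by an element of `H` maps each term of the lower Fitting series to itself. -/
theorem conj_mem_lowerFittingSeries [Finite G] {H : Subgroup G} {k : ℕ} {g a : G} (hg : g ∈ H)
    (ha : a ∈ H.lowerFittingSeries k) : g * a * g⁻¹ ∈ H.lowerFittingSeries k := by
  rw [← map_subtype_lowerFittingSeries_top] at ha ⊢
  obtain ⟨b, hb, rfl⟩ := ha
  exact ⟨⟨g, hg⟩ * b * ⟨g, hg⟩⁻¹, (lowerFittingSeries_normal ⊤ k).conj_mem b hb _, rfl⟩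

theorem exists_lowerFittingSeries_eq_bot [Finite G] (H : Subgroup G) [hH : Group.IsSolvable H] :
    ∃ k, H.lowerFittingSeries k = ⊥ := by
  obtain ⟨n, hn⟩ := (Group.isSolvable_def H).1 hH
  refine ⟨n, ?_⟩
  have : ∀ k, (⊤ : Subgroup H).lowerFittingSeries k ≤ derivedSeries H k := by
    intro k
    induction k with
    | zero => exact le_top
    | succ k ih =>
      rw [derivedSeries_succ, lowerFittingSeries_succ]
      exact (nilpotentResidual_le_lowerCentralSeries _ 1).trans (commutator_mono ih ih)
  rw [← map_subtype_lowerFittingSeries_top, eq_bot_iff.2 ((this n).trans hn.le), map_bot]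

/-! ### Joins of normal subgroups -/

/-- The containment says that two images in G/N centralise each other, a condition that passes to
joins. -/
theorem commutator_iSup_le {ι : Sort*} {A : ι → Subgroup G} {C N : Subgroup G} [N.Normal]
    (h : ∀ i, ⁅A i, C⁆ ≤ N) : ⁅⨆ i, A i, C⁆ ≤ N := by
  have key : ∀ X : Subgroup G, ⁅X, C⁆ ≤ N ↔
      X.map (QuotientGroup.mk' N) ≤ centralizer (C.map (QuotientGroup.mk' N)) := by
    intro X
    rw [← commutator_eq_bot_iff_le_centralizer, ← map_commutator, map_eq_bot_iff,
      QuotientGroup.ker_mk']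
  rw [key, map_iSup]
  exact iSup_le fun i => (key _).1 (h i)

theorem commutator_sup_le {A B C N : Subgroup G} [N.Normal] (h₁ : ⁅A, C⁆ ≤ N) (h₂ : ⁅B, C⁆ ≤ N) :
    ⁅A ⊔ B, C⁆ ≤ N := by
  rw [sup_eq_iSup]
  exact commutator_iSup_le (by simp [h₁, h₂])

/-- **Fitting's theorem**: the join of two normal nilpotent subgroups is nilpotent. -/
theorem exists_lowerCentralSeries_sup_eq_bot {A B : Subgroup G} [A.Normal] [B.Normal] {m n : ℕ}
    (hA : A.lowerCentralSeries m = ⊥) (hB : B.lowerCentralSeries n = ⊥) :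
    ∃ k, (A ⊔ B).lowerCentralSeries k = ⊥ := by
  -- Weights are shifted by one: weight 0 is the whole group, weight i + 1 is term i. A commutator
  -- with A raises the first weight and one with B the second, so term k of the join lies in the
  -- join of the intersections of total weight k + 1.
  let a : ℕ → Subgroup G := fun i => Nat.casesOn (motive := fun _ => Subgroup G) i ⊤ fun i => A.lowerCentralSeries i
  let b : ℕ → Subgroup G := fun i => Nat.casesOn (motive := fun _ => Subgroup G) i ⊤ fun i => B.lowerCentralSeries i
  have ha : ∀ i, (a i).Normal := by
    rintro (_ | i)
    · exact inferInstanceAs (⊤ : Subgroup G).Normal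
    · exact lowerCentralSeries_normal A i
  have hb : ∀ i, (b i).Normal := by
    rintro (_ | i)
    · exact inferInstanceAs (⊤ : Subgroup G).Normal
    · exact lowerCentralSeries_normal B i
  have haA : ∀ i, ⁅a i, A⁆ ≤ a (i + 1) := by
    rintro (_ | i)
    · exact commutator_le_right _ _
    · exact le_rfl
  have hbB : ∀ i, ⁅b i, B⁆ ≤ b (i + 1) := by
    rintro (_ | i)
    · exact commutator_le_right _ _
    · exact le_rfl
  have ha0 : ∀ i, m < i → a i = ⊥ := by
    rintro (_ | i) hi
    · omega
    · exact le_bot_iff.1 (hA ▸ A.lowerCentralSeries_antitone (Nat.lt_succ_iff.1 hi))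
  have hb0 : ∀ i, n < i → b i = ⊥ := by
    rintro (_ | i) hi
    · omega
    · exact le_bot_iff.1 (hB ▸ B.lowerCentralSeries_antitone (Nat.lt_succ_iff.1 hi))
  let S : ℕ → Subgroup G := fun k => ⨆ i : {i : ℕ × ℕ // i.1 + i.2 = k + 1}, a i.1.1 ⊓ b i.1.2
  have hS : ∀ k, (S k).Normal := by
    intro k
    have (i : {i : ℕ × ℕ // i.1 + i.2 = k + 1}) : (a i.1.1 ⊓ b i.1.2).Normal :=
      @normal_inf_normal _ _ _ _ (ha i.1.1) (hb i.1.2)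
    exact iSup_normal _
  have hle : ∀ k i j, i + j = k + 1 → a i ⊓ b j ≤ S k := fun k i j h =>
    le_iSup (fun i : {i : ℕ × ℕ // i.1 + i.2 = k + 1} => a i.1.1 ⊓ b i.1.2) ⟨(i, j), h⟩
  have key : ∀ k, (A ⊔ B).lowerCentralSeries k ≤ S k := by
    intro k
    induction k with
    | zero =>
      refine sup_le ?_ ?_
      · exact le_trans (le_inf le_rfl le_top) (hle 0 1 0 rfl)
      · exact le_trans (le_inf le_top le_rfl) (hle 0 0 1 rfl)
    | succ k ih =>
      rw [lowerCentralSeries_succ]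
      refine (commutator_mono ih le_rfl).trans (commutator_iSup_le ?_)
      rintro ⟨⟨i, j⟩, hij⟩
      rw [commutator_comm]
      refine commutator_sup_le ?_ ?_ <;> rw [commutator_comm]
      · refine le_trans (le_inf ?_ ?_) (hle (k + 1) (i + 1) j (by simp at hij; omega))
        · exact (commutator_mono inf_le_left le_rfl).trans (haA i)
        · exact (commutator_mono inf_le_right le_rfl).trans (commutator_le_left _ _)
      · refine le_trans (le_inf ?_ ?_) (hle (k + 1) i (j + 1) (by simp at hij; omega))
        · exact (commutator_mono inf_le_left le_rfl).trans (commutator_le_left _ _)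
        · exact (commutator_mono inf_le_right le_rfl).trans (hbB j)
  refine ⟨m + n, le_bot_iff.1 ((key _).trans (iSup_le ?_))⟩
  rintro ⟨⟨i, j⟩, hij⟩
  simp only at hij
  rcases le_or_gt i m with hi | hi
  · simp [hb0 j (by omega)]
  · simp [ha0 i hi]

/-- Modulo the right-hand side both factors are nilpotent, so Fitting's theorem applies in the
quotient. -/
theorem nilpotentResidual_sup_le [Finite G] (A B : Subgroup G) [A.Normal] [B.Normal] :
    (A ⊔ B).nilpotentResidual ≤ A.nilpotentResidual ⊔ B.nilpotentResidual := by
  set C := A.nilpotentResidual ⊔ B.nilpotentResidual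
  let f := QuotientGroup.mk' C
  have hf : Function.Surjective f := QuotientGroup.mk'_surjective C
  have hnil : ∀ X : Subgroup G, X.nilpotentResidual ≤ C → ∃ n, (X.map f).lowerCentralSeries n = ⊥ := by
    intro X hX
    obtain ⟨N, hN⟩ := X.exists_lowerCentralSeries_eq_nilpotentResidual
    refine ⟨N, ?_⟩
    rw [← map_lowerCentralSeries, hN N le_rfl, map_eq_bot_iff]
    simpa [f] using hX
  obtain ⟨m, hm⟩ := hnil A le_sup_left
  obtain ⟨n, hn⟩ := hnil B le_sup_right
  have := ‹A.Normal›.map f hf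
  have := ‹B.Normal›.map f hf
  obtain ⟨k, hk⟩ := exists_lowerCentralSeries_sup_eq_bot hm hn
  rw [← map_sup, ← map_lowerCentralSeries, map_eq_bot_iff, QuotientGroup.ker_mk'] at hk
  exact (nilpotentResidual_le_lowerCentralSeries _ k).trans hk

theorem lowerFittingSeries_sup_le [Finite G] (A B : Subgroup G) [A.Normal] [B.Normal] (k : ℕ) :
    (A ⊔ B).lowerFittingSeries k ≤ A.lowerFittingSeries k ⊔ B.lowerFittingSeries k := by
  induction k with
  | zero => rfl
  | succ k ih => exact (nilpotentResidual_mono ih).trans (nilpotentResidual_sup_le _ _)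

theorem card_sup_dvd [Finite G] (A B : Subgroup G) [B.Normal] :
    Nat.card (A ⊔ B : Subgroup G) ∣ Nat.card A * Nat.card B := by
  have h := relIndex_sup_right A B
  rw [← relIndex_bot_left, ← relIndex_mul_relIndex ⊥ B (A ⊔ B) bot_le le_sup_right, h,
    relIndex_bot_left, mul_comm]
  exact mul_dvd_mul_right (relIndex_dvd_card _ _) _

/-- If a prime divides the order of the `k`-th term of the lower Fitting series of a group generated
by `D`, then it divides the corresponding order for the normal closure of a single element of `D`. -/
theorem exists_dvd_card_lowerFittingSeries_normalClosure [Finite G] {D : Set G}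
    (hD : closure D = ⊤) {q : ℕ} (hq : q.Prime) {k : ℕ}
    (h : q ∣ Nat.card ((⊤ : Subgroup G).lowerFittingSeries k)) :
    ∃ x ∈ D, q ∣ Nat.card ((normalClosure {x}).lowerFittingSeries k) := by
  by_contra! hc
  -- The k-th term of a join lies in the join of the k-th terms, so adjoining the normal closure of
  -- x ∈ D to N creates no new factor q. A maximal N thus contains D.
  obtain ⟨N, -, hN⟩ := Finite.exists_le_maximal
    (p := fun N : Subgroup G => N.Normal ∧ ¬ q ∣ Nat.card (N.lowerFittingSeries k)) (a := ⊥)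
    ⟨inferInstance, by
      have : (⊥ : Subgroup G).lowerFittingSeries k = ⊥ := le_bot_iff.1 (lowerFittingSeries_le _ k)
      rw [this, card_bot]; exact hq.not_dvd_one⟩
  obtain ⟨⟨hn, hNq⟩, hmax⟩ := hN
  apply hNq
  rwa [show N = ⊤ from ?_]
  rw [eq_top_iff, ← hD, closure_le]
  intro x hx
  have := hmax (y := N ⊔ normalClosure {x}) ⟨inferInstance, fun hdvd => ?_⟩ le_sup_left
  · exact this (le_sup_right (a := N) (subset_normalClosure rfl))
  · rcases hq.dvd_mul.1 ((hdvd.trans (card_dvd_of_le (lowerFittingSeries_sup_le N _ k))).trans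
      (card_sup_dvd _ _)) with h | h
    · exact hNq h
    · exact hc x hx h

end Subgroup

/-! ### The Baer–Suzuki theorem -/

namespace IsPGroup

open Subgroup

variable {G : Type*} [Group G] [Finite G] {p : ℕ} [Fact p.Prime]

/-- If a conjugation-invariant set `D` meets a `p`-subgroup `P` outside `Q`, then some element of
`D ∩ P` outside `Q` normalises `D ∩ P ∩ Q`. -/
theorem exists_conj_mem_of_not_mem {D : Set G} (hD : ∀ a ∈ D, ∀ g, g * a * g⁻¹ ∈ D)
    {P Q : Subgroup G} (hP : IsPGroup p P) (h : ∃ d ∈ D, d ∈ P ∧ d ∉ Q) :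
    ∃ a ∈ D, a ∈ P ∧ a ∉ Q ∧ ∀ d ∈ D, d ∈ P → d ∈ Q → a * d * a⁻¹ ∈ Q := by
  -- X is proper in the nilpotent group P, so it grows in its normaliser in P, which by maximality
  -- meets D outside Q. Such an element conjugates D ∩ X into D ∩ X, hence into Q.
  obtain ⟨X, hX0, ⟨hXP, hXD⟩, hmax⟩ := Finite.exists_le_maximal
    (p := fun X : Subgroup G => X ≤ P ∧ ∀ d ∈ D, d ∈ X → d ∈ Q) (a := P ⊓ Q)
    ⟨inf_le_left, fun d _ h => h.2⟩
  obtain ⟨d, hd, hdP, hdQ⟩ := h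
  have hlt : X.subgroupOf P < ⊤ := by
    rw [lt_top_iff_ne_top, Ne, subgroupOf_eq_top]
    exact fun hle => hdQ (hXD d hd (hle hdP))
  have := hP.isNilpotent
  have hnc := Group.normalizerCondition_of_isNilpotent _ hlt
  have hlt' : X < (normalizer (X.subgroupOf P : Set P)).map P.subtype := by
    have := (map_lt_map_iff_of_injective P.subtype_injective).2 hnc
    rwa [subgroupOf_map_subtype, inf_eq_left.2 hXP] at this
  by_contra! hc
  refine hlt'.not_ge (hmax ⟨map_subtype_le _, ?_⟩ hlt'.le)
  rintro _ ha ⟨a, haN, rfl⟩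
  by_contra haQ
  obtain ⟨e, he, heP, heQ, hae⟩ := hc a ha a.2 haQ
  have heX : e ∈ X := hX0 ⟨heP, heQ⟩
  refine hae (hXD _ (hD e he _) ?_)
  exact (mem_normalizer_iff.1 haN ⟨e, heP⟩).1 heX

/-- The **Baer–Suzuki theorem** for `p`-groups: if any two elements of a conjugation-invariant
subset of a finite group generate a `p`-group, then so does the whole subset. -/
theorem closure_of_closure_pair {D : Set G} (hD : ∀ a ∈ D, ∀ g, g * a * g⁻¹ ∈ D)
    (h : ∀ a ∈ D, ∀ b ∈ D, IsPGroup p (closure {a, b})) : IsPGroup p (closure D) := by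
  by_contra hcon
  have hne : {x : Sylow p G × Sylow p G | D ∩ x.1 ≠ D ∩ x.2}.Nonempty := by
    by_contra hemp
    rw [Set.not_nonempty_iff_eq_empty] at hemp
    have hall : ∀ P Q : Sylow p G, D ∩ P = D ∩ Q := fun P Q => by
      by_contra hPQ
      exact (hemp.subset (show (P, Q) ∈ _ from hPQ))
    refine hcon ((default : Sylow p G).isPGroup'.to_le ?_)
    rw [closure_le]
    intro d hd
    obtain ⟨Q, hQ⟩ := (h d hd d hd).exists_le_sylow
    exact ((hall Q default).subset ⟨hd, hQ (subset_closure (by simp))⟩).2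
  -- Extremal choice: two Sylow subgroups with different traces on D whose common trace E is
  -- largest. Elements a and b outside the other subgroup normalise E, so a, b and E lie in one
  -- Sylow subgroup T; it shares more of D with P, which forces D ∩ P = D ∩ T and b ∈ P.
  obtain ⟨⟨P, Q⟩, hPQ, hmax⟩ := Set.exists_max_image _
    (fun x : Sylow p G × Sylow p G => (D ∩ x.1 ∩ x.2 : Set G).ncard) (Set.toFinite _) hne
  simp only [Set.mem_ofPred_eq, Prod.forall] at hPQ hmax
  have hcard : ∀ P Q : Sylow p G, (D ∩ P : Set G).ncard = (D ∩ Q : Set G).ncard := by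
    have key : ∀ P Q : Sylow p G, (D ∩ P : Set G).ncard ≤ (D ∩ Q : Set G).ncard := by
      intro P Q
      obtain ⟨g, rfl⟩ := MulAction.exists_smul_eq G P Q
      refine Set.ncard_le_ncard_of_injOn (fun x => g * x * g⁻¹) ?_ (by intro; simp) (Set.toFinite _)
      rintro x ⟨hx, hxP⟩
      exact ⟨hD x hx g, ⟨x, hxP, rfl⟩⟩
    exact fun P Q => le_antisymm (key P Q) (key Q P)
  have hexists : ∀ P Q : Sylow p G, D ∩ P ≠ D ∩ Q → ∃ d ∈ D, d ∈ (P : Subgroup G) ∧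
      d ∉ (Q : Subgroup G) := by
    intro P Q hPQ
    by_contra! hc
    exact hPQ (Set.eq_of_subset_of_ncard_le (fun d hd => ⟨hd.1, hc d hd.1 hd.2⟩) (hcard Q P).le
      (Set.toFinite _))
  obtain ⟨a, haD, haP, haQ, ha⟩ := exists_conj_mem_of_not_mem hD P.isPGroup' (hexists P Q hPQ)
  obtain ⟨b, hbD, hbQ, hbP, hb⟩ := exists_conj_mem_of_not_mem hD Q.isPGroup' (hexists Q P hPQ.symm)
  set E : Set G := D ∩ P ∩ Q with hE
  have haE : a ∈ normalizer E := mem_normalizer_fintype fun d hd =>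
    ⟨⟨hD d hd.1.1 a, mul_mem (mul_mem haP hd.1.2) (inv_mem haP)⟩, ha d hd.1.1 hd.1.2 hd.2⟩
  have hbE : b ∈ normalizer E := mem_normalizer_fintype fun d hd =>
    ⟨⟨hD d hd.1.1 b, hb d hd.1.1 hd.2 hd.1.2⟩, mul_mem (mul_mem hbQ hd.2) (inv_mem hbQ)⟩
  have hEp : IsPGroup p (closure E) :=
    P.isPGroup'.to_le ((closure_le _).2 fun d hd => hd.1.2)
  have hsup : IsPGroup p (closure {a, b} ⊔ closure E : Subgroup G) := by
    refine (h a haD b hbD).to_sup_of_normal_right' hEp ?_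
    refine le_trans ((closure_le _).2 ?_) (normalizer_le_normalizer_closure E)
    rintro x (rfl | rfl)
    exacts [haE, hbE]
  obtain ⟨T, hT⟩ := hsup.exists_le_sylow
  have haT : a ∈ T := hT (mem_sup_left (subset_closure (by simp)))
  have hbT : b ∈ T := hT (mem_sup_left (subset_closure (by simp)))
  have hET : E ⊆ T := fun d hd => hT (mem_sup_right (subset_closure hd))
  have hPT : D ∩ P = D ∩ T := by
    by_contra hne
    refine (hmax P T hne).not_gt (Set.ncard_lt_ncard ?_ (Set.toFinite _))
    exact ⟨fun d hd => ⟨hd.1, hET hd⟩, fun hsub => haQ (hsub ⟨⟨haD, haP⟩, haT⟩).2⟩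
  exact hbP (hPT.symm.subset ⟨hbD, hbT⟩).2

end IsPGroup

/-! ### Fixed points and commutators -/

open scoped Pointwise commutatorElement

section FixedSubgroup

variable {R W : Type*} [Group R] [CommGroup W] [MulDistribMulAction R W]

variable (W) in
/-- The subgroup of elements of `W` fixed by every element of `S`. -/
def fixedSubgroup (S : Set R) : Subgroup W where
  carrier := {w | ∀ g ∈ S, g • w = w}
  mul_mem' ha hb g hg := by rw [smul_mul', ha g hg, hb g hg]
  one_mem' g _ := smul_one g
  inv_mem' ha g hg := by rw [smul_inv', ha g hg]

theorem mem_fixedSubgroup {S : Set R} {w : W} : w ∈ fixedSubgroup W S ↔ ∀ g ∈ S, g • w = w :=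
  Iff.rfl

theorem mem_fixedSubgroup_singleton {x : R} {w : W} : w ∈ fixedSubgroup W {x} ↔ x • w = w := by
  simp [mem_fixedSubgroup]

theorem fixedSubgroup_inf_le_sup (X Y : Subgroup R) :
    fixedSubgroup W (X : Set R) ⊓ fixedSubgroup W (Y : Set R) ≤ fixedSubgroup W ((X ⊔ Y : Subgroup R) : Set R) := by
  rintro w ⟨hX, hY⟩
  have : X ⊔ Y ≤ MulAction.stabilizer R w := sup_le (fun g hg => hX g hg) (fun g hg => hY g hg)
  exact fun g hg => this hg

theorem smul_mem_fixedSubgroup {X : Subgroup R} {w : W} (hw : w ∈ fixedSubgroup W (X : Set R)) (g : R) :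
    g • w ∈ fixedSubgroup W ((ConjAct.toConjAct g • X : Subgroup R) : Set R) := by
  rintro _ ⟨a, ha, rfl⟩
  change (g * a * g⁻¹) • g • w = g • w
  rw [mul_smul, mul_smul, inv_smul_smul, hw a ha]

theorem smul_mem_fixedSubgroup_of_normal {N : Subgroup R} [hN : N.Normal] {w : W}
    (hw : w ∈ fixedSubgroup W (N : Set R)) (g : R) : g • w ∈ fixedSubgroup W (N : Set R) := by
  intro a ha
  have := hw (g⁻¹ * a * g) (by simpa using hN.conj_mem a ha g⁻¹)
  rw [mul_smul, mul_smul, inv_smul_eq_iff] at this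
  exact this

theorem Subgroup.card_mul_card_le [Finite W] (A B : Subgroup W) :
    Nat.card A * Nat.card B ≤ Nat.card W * Nat.card (A ⊓ B : Subgroup W) := by
  have h1 : Nat.card (A ⊓ B : Subgroup W) * B.relIndex A = Nat.card A := by
    rw [← Subgroup.relIndex_bot_left, ← Subgroup.relIndex_bot_left, ← Subgroup.inf_relIndex_left A B]
    exact Subgroup.relIndex_mul_relIndex _ _ _ bot_le inf_le_left
  have h2 := B.card_mul_index
  have h3 : B.relIndex A ≤ B.index := by
    rw [← Subgroup.relIndex_top_right]
    exact Subgroup.relIndex_le_of_le_right le_top (by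
      rw [Subgroup.relIndex_top_right]; exact B.index_ne_zero_of_finite)
  rw [← h1, ← h2]
  nlinarith [Nat.mul_le_mul_left (Nat.card (A ⊓ B : Subgroup W) * Nat.card B) h3]

variable [Finite W]

/-- The commutator is x times the inverse of a conjugate of x, so it fixes whatever both fix; the
two fixed subgroups have the same order. -/
theorem sq_card_fixedSubgroup_le (x u : R) :
    Nat.card (fixedSubgroup W {x}) ^ 2 ≤ Nat.card W * Nat.card (fixedSubgroup W {⁅x, u⁆}) := by
  have h1 : Nat.card (fixedSubgroup W {x}) ≤ Nat.card (fixedSubgroup W {u * x * u⁻¹}) := by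
    refine Nat.card_le_card_of_injective
      (fun w => ⟨u • w.1, mem_fixedSubgroup_singleton.2 ?_⟩) fun a b hab => ?_
    · rw [mul_smul, mul_smul, inv_smul_smul, mem_fixedSubgroup_singleton.1 w.2]
    · exact Subtype.ext (smul_left_cancel u (congrArg Subtype.val hab))
  have h2 : fixedSubgroup W {x} ⊓ fixedSubgroup W {u * x * u⁻¹} ≤ fixedSubgroup W {⁅x, u⁆} := by
    rintro w ⟨ha, hb⟩
    have ha := mem_fixedSubgroup_singleton.1 ha
    have hb := mem_fixedSubgroup_singleton.1 hb
    rw [mem_fixedSubgroup_singleton, show ⁅x, u⁆ = x * (u * x * u⁻¹)⁻¹ by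
      simp [commutatorElement_def, mul_assoc], mul_smul, inv_smul_eq_iff.2 hb.symm, ha]
  calc _ ≤ Nat.card (fixedSubgroup W {x}) * Nat.card (fixedSubgroup W {u * x * u⁻¹}) := by
        rw [sq]; exact Nat.mul_le_mul_left _ h1
    _ ≤ _ := Subgroup.card_mul_card_le _ _
    _ ≤ _ := Nat.mul_le_mul_left _ (Subgroup.card_le_of_le h2)

theorem sq_card_fixedSubgroup_le_of_commutator_eq_bot {x u : R}
    (h : fixedSubgroup W {⁅x, u⁆} = ⊥) : Nat.card (fixedSubgroup W {x}) ^ 2 ≤ Nat.card W := by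
  simpa [h] using sq_card_fixedSubgroup_le (W := W) x u

end FixedSubgroup

/-! ### Imprimitive modules -/

/-- T takes one point from each cycle; no cycle is a single point, so the complement meets each
cycle too. -/
theorem Equiv.Perm.exists_set_of_forall_ne {α : Type*} (σ : Equiv.Perm α) (h : ∀ a, σ a ≠ a) :
    ∃ T : Set α, ∀ a, (∃ i : ℤ, (σ ^ i) a ∈ T) ∧ ∃ i : ℤ, (σ ^ i) a ∉ T := by
  let s := Equiv.Perm.SameCycle.setoid σ
  refine ⟨{a | (Quotient.mk s a).out = a}, fun a => ?_⟩
  obtain ⟨i, hi⟩ : σ.SameCycle a (Quotient.mk s a).out := (Quotient.mk_out (s := s) a).symm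
  have hq : ∀ j : ℤ, Quotient.mk s ((σ ^ j) a) = Quotient.mk s a := fun j =>
    Quotient.sound (s := s) (show σ.SameCycle _ _ from
      (Equiv.Perm.sameCycle_zpow_left).2 (Equiv.Perm.SameCycle.refl _ _))
  refine ⟨⟨i, ?_⟩, 1 + i, ?_⟩
  · rw [Set.mem_ofPred, hq, hi]
  · rw [Set.mem_ofPred, hq, zpow_add, Equiv.Perm.mul_apply, hi, zpow_one]
    exact (h _).symm

section Imprimitive

variable {R W : Type*} [Group R] [CommGroup W] [MulDistribMulAction R W]

/-- Fixed subgroups of distinct subgroups of an abelian group which are maximal with respect to having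
nontrivial fixed points are independent. -/
theorem eq_one_of_prod_fixedSubgroup_eq_one {Ω : Set (Subgroup R)} [Fintype Ω]
    (hcomm : ∀ X ∈ Ω, ∀ Y ∈ Ω, ∀ a ∈ X, ∀ b ∈ Y, a * b = b * a)
    (hmax : ∀ X ∈ Ω, ∀ Y ∈ Ω,
      fixedSubgroup W ((X ⊔ Y : Subgroup R) : Set R) ≠ ⊥ → X = Y)
    (f : Ω → W) (hf : ∀ X : Ω, f X ∈ fixedSubgroup W (X.1 : Set R)) (h1 : ∏ X, f X = 1) :
    f = 1 := by
  classical
  induction hn : (Finset.univ.filter fun X => f X ≠ 1).card using Nat.strong_induction_on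
    generalizing f with
  | _ n ih =>
  by_contra hne
  obtain ⟨X₀, hX₀⟩ := Function.ne_iff.1 hne
  obtain ⟨X₁, hX₁, hX₀₁⟩ : ∃ X₁, f X₁ ≠ 1 ∧ X₁ ≠ X₀ := by
    by_contra! hc
    rw [Fintype.prod_eq_single X₀ fun X hX => by_contra fun h => hX (hc X h)] at h1
    exact hX₀ h1
  -- As in the independence of characters: dividing b • f by f kills the coordinate at X₀ without
  -- enlarging the support, so the quotient is trivial by induction.
  have key : ∀ b ∈ X₀.1, b • f X₁ = f X₁ := by
    intro b hb
    have := ih _ ?_ (fun X => (b • f X) / f X) ?_ ?_ rfl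
    · have := congrFun this X₁
      exact div_eq_one.1 this
    · rw [← hn]
      refine Finset.card_lt_card ⟨?_, fun hsub => ?_⟩
      · intro X
        simp only [Finset.mem_filter, Finset.mem_univ, true_and]
        intro hX hX'
        exact hX (by simp [hX'])
      · have := hsub (Finset.mem_filter.2 ⟨Finset.mem_univ X₀, hX₀⟩)
        simp only [Finset.mem_filter, Finset.mem_univ, true_and] at this
        exact this (by rw [hf X₀ b hb, div_self'])
    · intro X
      refine div_mem (fun a ha => ?_) (hf X)
      rw [← mul_smul, hcomm X X.2 X₀ X₀.2 a ha b hb, mul_smul, hf X a ha]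
    · rw [Finset.prod_div_distrib, ← Finset.smul_prod', h1, smul_one, div_one]
  refine hX₀₁ (Subtype.ext (hmax X₀ X₀.2 X₁ X₁.2 ?_)).symm
  rw [Subgroup.ne_bot_iff_exists_ne_one]
  exact ⟨⟨f X₁, fixedSubgroup_inf_le_sup _ _ ⟨key, hf X₁⟩⟩, fun h => hX₁ (congrArg Subtype.val h)⟩

variable [Finite R] [Finite W]

/-- Let `W` be an irreducible module, `A` an abelian normal subgroup, `B ≤ A` of maximal order subject
to having nontrivial fixed points. An element normalising no conjugate of `B` has at most `√|W|`
fixed points. -/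
theorem sq_card_fixedSubgroup_le_of_forall_smul_ne
    (hirr : ∀ U : Subgroup W, (∀ g : R, ∀ u ∈ U, g • u ∈ U) → U = ⊥ ∨ U = ⊤)
    {A B : Subgroup R} [hA : A.Normal] (hcomm : ∀ a ∈ A, ∀ b ∈ A, a * b = b * a) (hBA : B ≤ A)
    (hB : fixedSubgroup W (B : Set R) ≠ ⊥)
    (hmax : ∀ X : Subgroup R, X ≤ A → fixedSubgroup W (X : Set R) ≠ ⊥ → Nat.card X ≤ Nat.card B)
    {g : R} (hg : ∀ h : ConjAct R, ConjAct.toConjAct g • h • B ≠ h • B) :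
    Nat.card (fixedSubgroup W {g}) ^ 2 ≤ Nat.card W := by
  classical
  let Ω : Set (Subgroup R) := MulAction.orbit (ConjAct R) B
  have : Fintype Ω := Fintype.ofFinite Ω
  have hΩA : ∀ X ∈ Ω, X ≤ A := by
    rintro _ ⟨h, rfl⟩ _ ⟨b, hb, rfl⟩
    exact hA.conj_mem b (hBA hb) _
  have hΩcard : ∀ X ∈ Ω, Nat.card X = Nat.card B := by
    rintro _ ⟨h, rfl⟩
    exact (Nat.card_congr (Subgroup.equivSMul h B).toEquiv).symm
  have hindep := eq_one_of_prod_fixedSubgroup_eq_one (W := W) (Ω := Ω)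
    (fun X hX Y hY a ha b hb => hcomm a (hΩA X hX ha) b (hΩA Y hY hb))
    (fun X hX Y hY hXY => by
      have h := hmax _ (sup_le (hΩA X hX) (hΩA Y hY)) hXY
      have h1 := Subgroup.eq_of_le_of_card_ge (le_sup_left : X ≤ X ⊔ Y) (by rwa [hΩcard X hX])
      have h2 := Subgroup.eq_of_le_of_card_ge (le_sup_right : Y ≤ X ⊔ Y) (by rwa [hΩcard Y hY])
      exact h1.trans h2.symm)
  let Φ : (∀ X : Ω, fixedSubgroup W (X.1 : Set R)) →* W :=
    { toFun := fun f => ∏ X, (f X : W)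
      map_one' := by simp
      map_mul' := fun f f' => by simp [Finset.prod_mul_distrib] }
  have hΦ : ∀ f, Φ f = ∏ X, (f X : W) := fun f => rfl
  have hinj : Function.Injective Φ := by
    rw [injective_iff_map_eq_one]
    intro f hf
    have := hindep (fun X => f X) (fun X => (f X).2) hf
    funext X
    exact Subtype.ext (congrFun this X)
  -- The action of R on the product of the blocks that makes Φ equivariant. The range of Φ is then a
  -- submodule, so irreducibility makes Φ onto.
  let act : R → (∀ X : Ω, fixedSubgroup W (X.1 : Set R)) → ∀ X : Ω, fixedSubgroup W (X.1 : Set R) :=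
    fun k f X => ⟨k • (f ((ConjAct.toConjAct k)⁻¹ • X) : W), by
      have h : ConjAct.toConjAct k • ((ConjAct.toConjAct k)⁻¹ • X).1 = X.1 :=
        congrArg Subtype.val (smul_inv_smul (ConjAct.toConjAct k) X)
      have h' := congrArg (fun Y : Subgroup R => fixedSubgroup W (Y : Set R)) h
      exact h'.le (smul_mem_fixedSubgroup (f ((ConjAct.toConjAct k)⁻¹ • X)).2 k)⟩
  have hact : ∀ k f, Φ (act k f) = k • Φ f := by
    intro k f
    rw [hΦ, hΦ, Finset.smul_prod']
    exact Fintype.prod_equiv (MulAction.toPerm (ConjAct.toConjAct k)⁻¹) _ _ fun X => rfl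
  have hsurj : Function.Surjective Φ := by
    rw [← MonoidHom.range_eq_top]
    refine (hirr Φ.range ?_).resolve_left ?_
    · rintro k _ ⟨f, rfl⟩
      exact ⟨act k f, hact k f⟩
    · intro hbot
      refine hB (eq_bot_iff.2 fun w hw => ?_)
      rw [← hbot]
      refine ⟨Pi.mulSingle ⟨B, MulAction.mem_orbit_self B⟩ ⟨w, hw⟩, ?_⟩
      rw [hΦ, Fintype.prod_eq_single ⟨B, MulAction.mem_orbit_self B⟩, Pi.mulSingle_eq_same]
      intro X hX
      rw [Pi.mulSingle_eq_of_ne hX]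
      rfl
  obtain ⟨T, hT⟩ := Equiv.Perm.exists_set_of_forall_ne
    (MulAction.toPerm (ConjAct.toConjAct g) : Equiv.Perm Ω) (by
      rintro ⟨_, h, rfl⟩ heq
      exact hg h (congrArg Subtype.val heq))
  let e := MulEquiv.ofBijective Φ ⟨hinj, hsurj⟩
  have hfix : ∀ w ∈ fixedSubgroup W {g}, ∀ X : Ω, ∀ i : ℤ,
      (e.symm w ((MulAction.toPerm (ConjAct.toConjAct g) ^ i : Equiv.Perm Ω) X) : W) = 1 →
        (e.symm w X : W) = 1 := by
    intro w hw
    have hgw := mem_fixedSubgroup_singleton.1 hw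
    have h1 : act g (e.symm w) = e.symm w := hinj (by
      rw [hact]
      have : Φ (e.symm w) = w := e.apply_symm_apply w
      rw [this, hgw])
    let φ : Ω → W := fun X => (e.symm w X : W)
    have h2 : ∀ X : Ω, g • φ ((ConjAct.toConjAct g)⁻¹ • X) = φ X := fun X =>
      congrArg Subtype.val (congrFun h1 X)
    let σ : Equiv.Perm Ω := MulAction.toPerm (ConjAct.toConjAct g)
    have h3 : ∀ X : Ω, φ (σ X) = 1 ↔ φ X = 1 := by
      intro X
      rw [← h2, MulAction.toPerm_apply, inv_smul_smul, smul_eq_iff_eq_inv_smul, smul_one]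
    intro X i
    change φ ((σ ^ i) X) = 1 → φ X = 1
    refine Iff.mp ?_
    induction i with
    | zero => simp
    | succ i ih => rw [add_comm, zpow_add, Equiv.Perm.mul_apply, ← ih, zpow_one]; exact h3 _
    | pred i ih =>
      rw [← ih, sub_eq_neg_add, zpow_add, Equiv.Perm.mul_apply, zpow_neg_one, ← h3]
      exact iff_of_eq (congrArg (fun Y => φ Y = 1) (σ.apply_symm_apply _))
  -- A fixed point of g is determined by its coordinates in any set of blocks meeting every cycle of
  -- g. Both T and its complement qualify, and their two products multiply to |W|.
  have hle : ∀ S : Set Ω, (∀ X, ∃ i : ℤ, (MulAction.toPerm (ConjAct.toConjAct g) ^ i : Equiv.Perm Ω) X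
      ∈ S) → Nat.card (fixedSubgroup W {g}) ≤ ∏ X ∈ Finset.univ.filter (· ∈ S),
        Nat.card (fixedSubgroup W (X.1 : Set R)) := by
    intro S hS
    have h1 : Nat.card (∀ X : {X // X ∈ Finset.univ.filter (· ∈ S)},
        fixedSubgroup W (X.1.1 : Set R)) = ∏ X ∈ Finset.univ.filter (· ∈ S),
        Nat.card (fixedSubgroup W (X.1 : Set R)) := by
      rw [Nat.card_pi, Finset.prod_coe_sort _ fun X : Ω => Nat.card (fixedSubgroup W (X.1 : Set R))]
    rw [← h1]
    let ψ : fixedSubgroup W {g} →* (∀ X : {X // X ∈ Finset.univ.filter (· ∈ S)},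
        fixedSubgroup W (X.1.1 : Set R)) :=
      { toFun := fun w X => e.symm w X.1
        map_one' := by simp; rfl
        map_mul' := fun a b => by simp; rfl }
    refine Nat.card_le_card_of_injective ψ ((injective_iff_map_eq_one ψ).2 fun w hw => ?_)
    have : e.symm w = 1 := by
      funext X
      obtain ⟨i, hi⟩ := hS X
      refine Subtype.ext (hfix w w.2 X i ?_)
      exact congrArg Subtype.val (congrFun hw ⟨_, Finset.mem_filter.2 ⟨Finset.mem_univ _, hi⟩⟩)
    exact Subtype.ext (by simpa using this)
  have hW : Nat.card W = ∏ X : Ω, Nat.card (fixedSubgroup W (X.1 : Set R)) := by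
    rw [← Nat.card_pi]
    exact (Nat.card_congr e.toEquiv).symm
  rw [hW, ← Finset.prod_filter_mul_prod_filter_not _ (· ∈ T), sq]
  refine Nat.mul_le_mul (hle T fun X => (hT X).1) ((hle Tᶜ fun X => (hT X).2).trans_eq ?_)
  exact Finset.prod_congr (by ext; simp) fun _ _ => rfl

end Imprimitive

/-! ### The fixed-point bound -/

namespace Subgroup

variable {G : Type*} [Group G]

theorem toConjAct_smul_eq_iff {g : G} {B : Subgroup G} :
    ConjAct.toConjAct g • B = B ↔ g ∈ normalizer (B : Set G) :=
  mem_normalizer_iff_map_conj_eq.symm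

theorem eq_top_of_mem_of_normalClosure_eq_top {x : G} (hx : normalClosure {x} = ⊤) {N : Subgroup G}
    [N.Normal] (h : x ∈ N) : N = ⊤ :=
  top_le_iff.1 (hx ▸ normalClosure_le_normal (Set.singleton_subset_iff.2 h))

/-- The centraliser of N is normal, so it would be everything if it contained x. -/
theorem exists_commutator_ne_one {x : G} (hx : normalClosure {x} = ⊤) {N : Subgroup G}
    [N.Normal] (h : ¬ N ≤ center G) : ∃ u ∈ N, ⁅x, u⁆ ≠ 1 := by
  by_contra! hc
  refine h ?_
  have : centralizer (N : Set G) = ⊤ := eq_top_of_mem_of_normalClosure_eq_top hx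
    (mem_centralizer_iff.2 fun u hu => (commutatorElement_eq_one_iff_mul_comm.1 (hc u hu)).symm)
  rwa [centralizer_eq_top_iff_subset] at this

theorem commutator_mem_of_mem_right {N : Subgroup G} [hN : N.Normal] (x : G) {u : G} (hu : u ∈ N) :
    ⁅x, u⁆ ∈ N := commutator_le_right ⊤ N (commutator_mem_commutator (mem_top x) hu)

end Subgroup

open Subgroup

section FixedPointBound

variable {R W : Type*} [Group R] [CommGroup W] [MulDistribMulAction R W]

/-- The fixed points of a central element form a submodule, which is not all of W by faithfulness.
-/
theorem fixedSubgroup_singleton_eq_bot_of_mem_center [FaithfulSMul R W]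
    (hirr : ∀ U : Subgroup W, (∀ g : R, ∀ u ∈ U, g • u ∈ U) → U = ⊥ ∨ U = ⊤) {z : R}
    (hz : z ∈ center R) (hz1 : z ≠ 1) : fixedSubgroup W {z} = ⊥ := by
  refine (hirr _ fun g u hu => ?_).resolve_right fun htop => hz1 ?_
  · rw [mem_fixedSubgroup_singleton] at hu ⊢
    rw [← mul_smul, ← mem_center_iff.1 hz g, mul_smul, hu]
  · refine FaithfulSMul.eq_of_smul_eq_smul (α := W) fun w => ?_
    rw [one_smul]
    exact mem_fixedSubgroup_singleton.1 (htop ▸ mem_top w)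

variable [Finite W]

theorem card_fixedSubgroup_pow_four_le_of_sq {x : R}
    (h : Nat.card (fixedSubgroup W {x}) ^ 2 ≤ Nat.card W) :
    Nat.card (fixedSubgroup W {x}) ^ 4 ≤ Nat.card W ^ 3 :=
  calc _ = (Nat.card (fixedSubgroup W {x}) ^ 2) ^ 2 := by ring
    _ ≤ Nat.card W ^ 2 := Nat.pow_le_pow_left h 2
    _ ≤ _ := Nat.pow_le_pow_right Nat.card_pos (by norm_num)

/-- Source of the exponent 3/4: a bound |W|^(1/2) for [x, u] gives |W|^((1 + 1/2)/2) for x. -/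
theorem card_fixedSubgroup_pow_four_le_of_commutator {x u : R}
    (h : Nat.card (fixedSubgroup W {⁅x, u⁆}) ^ 2 ≤ Nat.card W) :
    Nat.card (fixedSubgroup W {x}) ^ 4 ≤ Nat.card W ^ 3 :=
  calc _ = (Nat.card (fixedSubgroup W {x}) ^ 2) ^ 2 := by ring
    _ ≤ (Nat.card W * Nat.card (fixedSubgroup W {⁅x, u⁆})) ^ 2 :=
      Nat.pow_le_pow_left (sq_card_fixedSubgroup_le x u) 2
    _ = Nat.card W ^ 2 * Nat.card (fixedSubgroup W {⁅x, u⁆}) ^ 2 := by ring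
    _ ≤ Nat.card W ^ 2 * Nat.card W := Nat.mul_le_mul_left _ h
    _ = _ := by ring

variable [Finite R]

/-- The fixed point bound when all abelian normal subgroups are central. -/
theorem card_fixedSubgroup_pow_four_le_of_forall_le_center [FaithfulSMul R W] [Group.IsSolvable R]
    [Nontrivial R] (hirr : ∀ U : Subgroup W, (∀ g : R, ∀ u ∈ U, g • u ∈ U) → U = ⊥ ∨ U = ⊤)
    {x : R} (hx : normalClosure {x} = ⊤)
    (hab : ∀ A : Subgroup R, A.Normal → (∀ a ∈ A, ∀ b ∈ A, a * b = b * a) → A ≤ center R) :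
    Nat.card (fixedSubgroup W {x}) ^ 4 ≤ Nat.card W ^ 3 := by
  have hcent := fun z => fixedSubgroup_singleton_eq_bot_of_mem_center (z := z) hirr
  by_cases hR : center R = ⊤
  · have hx1 : x ≠ 1 := by
      rintro rfl
      exact bot_ne_top ((normalClosure_eq_bot_iff.2 (by simp)).symm.trans hx)
    rw [hcent x (hR ▸ mem_top x) hx1]
    simpa using Nat.one_le_pow _ _ Nat.card_pos
  -- By solvability and minimality, the derived subgroup of N is central.
  obtain ⟨N, -, ⟨hN, hNc⟩, hmin⟩ := exists_minimal_le_of_wellFoundedLT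
    (fun N : Subgroup R => N.Normal ∧ ¬ N ≤ center R) ⊤
    ⟨inferInstance, fun h => hR (top_le_iff.1 h)⟩
  have hNN : ⁅N, N⁆ ≤ center R := by
    by_contra hc
    have hlt := Group.IsSolvable.commutator_lt_of_ne_bot (H := N) fun h => hNc (h ▸ bot_le)
    exact hlt.not_ge (hmin ⟨inferInstance, hc⟩ hlt.le)
  obtain ⟨u, huN, hu⟩ := exists_commutator_ne_one hx hNc
  have hgN : ⁅x, u⁆ ∈ N := commutator_mem_of_mem_right x huN
  by_cases hg : ⁅x, u⁆ ∈ center R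
  · exact card_fixedSubgroup_pow_four_le_of_sq
      (sq_card_fixedSubgroup_le_of_commutator_eq_bot (hcent _ hg hu))
  -- The centre of N is abelian and normal, hence central in R, so [x, u] fails to commute with some
  -- h ∈ N. Then [[x, u], h] is central and nontrivial, which bounds [x, u] and so x.
  have hgc : ⁅x, u⁆ ∉ centralizer (N : Set R) := by
    intro hgc
    refine hg (hab (N ⊓ centralizer N) inferInstance ?_ ⟨hgN, hgc⟩)
    rintro a ⟨ha, -⟩ b ⟨-, hb⟩
    exact hb a ha
  rw [mem_centralizer_iff] at hgc
  push Not at hgc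
  obtain ⟨h, hh, hne⟩ := hgc
  refine card_fixedSubgroup_pow_four_le_of_commutator (u := u)
    (sq_card_fixedSubgroup_le_of_commutator_eq_bot (u := h) (hcent _ ?_ ?_))
  · exact hNN (commutator_mem_commutator hgN hh)
  · rw [Ne, commutatorElement_eq_one_iff_mul_comm]
    exact hne.symm

/-- The fixed point bound when there is a noncentral abelian normal subgroup. -/
theorem card_fixedSubgroup_pow_four_le_of_not_le_center [FaithfulSMul R W] [Group.IsSolvable R]
    [Nontrivial R] (hirr : ∀ U : Subgroup W, (∀ g : R, ∀ u ∈ U, g • u ∈ U) → U = ⊥ ∨ U = ⊤)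
    {x : R} (hx : normalClosure {x} = ⊤) {A : Subgroup R} [A.Normal]
    (hA : ∀ a ∈ A, ∀ b ∈ A, a * b = b * a) (hAc : ¬ A ≤ center R) :
    Nat.card (fixedSubgroup W {x}) ^ 4 ≤ Nat.card W ^ 3 := by
  have htriv : fixedSubgroup W ((⊥ : Subgroup R) : Set R) ≠ ⊥ := by
    intro h
    obtain ⟨r, hr⟩ := exists_ne (1 : R)
    refine hr (FaithfulSMul.eq_of_smul_eq_smul (α := W) fun w => ?_)
    have hw : w ∈ fixedSubgroup W ((⊥ : Subgroup R) : Set R) := by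
      intro g hg
      rw [mem_bot.1 hg, one_smul]
    rw [h, mem_bot] at hw
    rw [hw, smul_one, smul_one]
  obtain ⟨B, ⟨hBA, hB⟩, hmax⟩ := Set.exists_max_image
    {X : Subgroup R | X ≤ A ∧ fixedSubgroup W (X : Set R) ≠ ⊥} (fun X => Nat.card X)
    (Set.toFinite _) ⟨⊥, bot_le, htriv⟩
  -- If B is normal, its fixed points are a nontrivial submodule, hence all of W, so B is trivial.
  -- By maximality no nontrivial element of A then has a nontrivial fixed point.
  by_cases hBn : B.Normal
  · have hB1 : B = ⊥ := by
      rw [eq_bot_iff]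
      intro b hb
      refine mem_bot.2 (FaithfulSMul.eq_of_smul_eq_smul (α := W) fun w => ?_)
      have htop := (hirr _ fun g u hu => smul_mem_fixedSubgroup_of_normal hu g).resolve_left hB
      rw [one_smul]
      exact (htop ▸ mem_top w : w ∈ fixedSubgroup W (B : Set R)) b hb
    obtain ⟨a, ha, hxa⟩ := exists_commutator_ne_one hx hAc
    refine card_fixedSubgroup_pow_four_le_of_sq
      (sq_card_fixedSubgroup_le_of_commutator_eq_bot (u := a) ?_)
    by_contra hne
    have hcard := hmax (zpowers ⁅x, a⁆)
      ⟨zpowers_le.2 (commutator_mem_of_mem_right x ha), ?_⟩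
    · rw [hB1, card_bot] at hcard
      exact hxa (zpowers_eq_bot.1 (card_le_one_iff_eq_bot _ |>.1 hcard))
    · refine fun h => hne (le_bot_iff.1 (le_trans (fun w hw => ?_) h.le))
      have : zpowers ⁅x, a⁆ ≤ MulAction.stabilizer R w :=
        zpowers_le.2 (mem_fixedSubgroup_singleton.1 hw)
      exact fun g hg => this hg
  obtain ⟨M, hM, hBM⟩ := (eq_top_or_exists_le_coatom (normalizer (B : Set R))).resolve_left
    fun h => hBn (normalizer_eq_top_iff.1 h)
  -- M contains the normaliser of B, so an element with no conjugate in M normalises no conjugate of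
  -- B.
  have hperm : ∀ g : R, (∀ h : R, h⁻¹ * g * h ∉ M) →
      Nat.card (fixedSubgroup W {g}) ^ 2 ≤ Nat.card W := by
    intro g hg
    refine sq_card_fixedSubgroup_le_of_forall_smul_ne hirr hA hBA hB
      (fun X hX hX' => hmax X ⟨hX, hX'⟩) fun h heq => hg (ConjAct.ofConjAct h) (hBM ?_)
    rw [← toConjAct_smul_eq_iff, map_mul, map_mul, map_inv, ConjAct.toConjAct_ofConjAct, mul_smul,
      mul_smul, heq, inv_smul_smul]
  obtain ⟨E, -, ⟨hE, hEM⟩, hmin⟩ := exists_minimal_le_of_wellFoundedLT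
    (fun E : Subgroup R => E.Normal ∧ ¬ E ≤ M) ⊤
    ⟨inferInstance, fun h => hM.1 (top_le_iff.1 h)⟩
  have hEE : ⁅E, E⁆ ≤ M := by
    by_contra hc
    have hlt := Group.IsSolvable.commutator_lt_of_ne_bot (H := E) fun h => hEM (h ▸ bot_le)
    exact hlt.not_ge (hmin ⟨inferInstance, hc⟩ hlt.le)
  have hsup : M ⊔ E = ⊤ := hM.2 _ (left_lt_sup.2 hEM)
  have hconj : ∀ e m : R, e * m * e⁻¹ = ⁅e, m⁆ * m := fun e m => by simp [commutatorElement_def]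
  have hD : (E ⊓ M).Normal := by
    rw [← normalizer_eq_top_iff, ← top_le_iff, ← hsup]
    refine sup_le ?_ ?_
    · exact fun m hm => mem_normalizer_fintype fun d hd =>
        ⟨hE.conj_mem d hd.1 m, M.mul_mem (M.mul_mem hm hd.2) (M.inv_mem hm)⟩
    · refine fun e he => mem_normalizer_fintype fun d hd => ⟨hE.conj_mem d hd.1 e, ?_⟩
      rw [hconj]
      exact mul_mem (hEE (commutator_mem_commutator he hd.1)) hd.2
  -- If [x, u] ∈ E lies outside the normal subgroup E ⊓ M, none of its conjugates is in M. Otherwise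
  -- x, and hence R, centralises E modulo E ⊓ M; then M is normal and contains no conjugate of x.
  by_cases hu : ∃ u ∈ E, ⁅x, u⁆ ∉ M
  · obtain ⟨u, huE, hu⟩ := hu
    refine card_fixedSubgroup_pow_four_le_of_commutator (u := u) (hperm _ fun h hh => hu ?_)
    have hgE : h⁻¹ * ⁅x, u⁆ * h ∈ E := by
      simpa using hE.conj_mem _ (commutator_mem_of_mem_right x huE) h⁻¹
    have := (hD.conj_mem _ ⟨hgE, hh⟩ h).2
    simpa [mul_assoc] using this
  · push Not at hu
    refine card_fixedSubgroup_pow_four_le_of_sq (hperm _ fun h hh => ?_)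
    have hT : (centralizer (E.map (QuotientGroup.mk' (E ⊓ M)) : Set (R ⧸ (E ⊓ M)))).comap
        (QuotientGroup.mk' (E ⊓ M)) = ⊤ := by
      have := hE.map _ (QuotientGroup.mk'_surjective (E ⊓ M))
      refine eq_top_of_mem_of_normalClosure_eq_top hx ?_
      rw [mem_comap, mem_centralizer_iff]
      rintro _ ⟨u, huE, rfl⟩
      rw [eq_comm, ← commutatorElement_eq_one_iff_mul_comm, ← map_commutatorElement]
      exact (QuotientGroup.eq_one_iff _).2 ⟨commutator_mem_of_mem_right x huE, hu u huE⟩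
    have hMn : M.Normal := by
      rw [← normalizer_eq_top_iff, ← top_le_iff, ← hsup]
      refine sup_le le_normalizer fun e he => mem_normalizer_fintype fun m hm => ?_
      have h1 : m ∈ (centralizer (E.map (QuotientGroup.mk' (E ⊓ M)) : Set (R ⧸ (E ⊓ M)))).comap
        (QuotientGroup.mk' (E ⊓ M)) := hT ▸ mem_top m
      have h2 := mem_centralizer_iff.1 h1 _ ⟨e, he, rfl⟩
      rw [← commutatorElement_eq_one_iff_mul_comm, ← map_commutatorElement] at h2
      have h3 := ((QuotientGroup.eq_one_iff _).1 h2).2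
      rw [hconj]
      exact mul_mem h3 hm
    have hxM : x ∈ M := by simpa [mul_assoc] using hMn.conj_mem _ hh h
    exact hM.1 (eq_top_of_mem_of_normalClosure_eq_top hx hxM)

theorem card_fixedSubgroup_pow_four_le_of_faithful [FaithfulSMul R W] [Group.IsSolvable R]
    [Nontrivial R] (hirr : ∀ U : Subgroup W, (∀ g : R, ∀ u ∈ U, g • u ∈ U) → U = ⊥ ∨ U = ⊤)
    {x : R} (hx : normalClosure {x} = ⊤) :
    Nat.card (fixedSubgroup W {x}) ^ 4 ≤ Nat.card W ^ 3 := by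
  by_cases hab : ∀ A : Subgroup R, A.Normal → (∀ a ∈ A, ∀ b ∈ A, a * b = b * a) → A ≤ center R
  · exact card_fixedSubgroup_pow_four_le_of_forall_le_center hirr hx hab
  · push Not at hab
    obtain ⟨A, hAn, hA, hAc⟩ := hab
    exact card_fixedSubgroup_pow_four_le_of_not_le_center hirr hx hA hAc

end FixedPointBound

/-- Let a finite solvable group, the normal closure of an element `x`, act irreducibly and
nontrivially on a finite abelian group `W`. Then `x` fixes at most `|W|^(3/4)` elements. -/
theorem card_fixedSubgroup_pow_four_le {R W : Type*} [Group R] [CommGroup W]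
    [MulDistribMulAction R W] [Finite W] [Group.IsSolvable R]
    (hirr : ∀ U : Subgroup W, (∀ g : R, ∀ u ∈ U, g • u ∈ U) → U = ⊥ ∨ U = ⊤)
    (hnt : ∃ (g : R) (w : W), g • w ≠ w) {x : R} (hx : normalClosure {x} = ⊤) :
    Nat.card (fixedSubgroup W {x}) ^ 4 ≤ Nat.card W ^ 3 := by
  let ρ := (MulDistribMulAction.toMulAut R W).rangeRestrict
  have hρ : Function.Surjective ρ := MonoidHom.rangeRestrict_surjective _
  have hact : ∀ (g : R) (w : W), ρ g • w = g • w := fun g w => rfl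
  have hS : Group.IsSolvable (MulDistribMulAction.toMulAut R W).range :=
    Group.isSolvable_of_surjective hρ
  have hN : Nontrivial (MulDistribMulAction.toMulAut R W).range := by
    obtain ⟨g, w, hgw⟩ := hnt
    refine ⟨ρ g, 1, fun h => hgw ?_⟩
    rw [← hact, h, one_smul]
  have hfix : fixedSubgroup W {x} = fixedSubgroup W {ρ x} := by
    ext w
    rw [mem_fixedSubgroup_singleton, mem_fixedSubgroup_singleton, hact]
  rw [hfix]
  refine card_fixedSubgroup_pow_four_le_of_faithful (fun U hU => hirr U fun g => hU (ρ g)) ?_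
  rw [← Set.image_singleton, ← map_normalClosure _ _ hρ, hx, map_top_of_surjective _ hρ]

/-! ### Sylow subgroups of nilpotent groups -/

namespace Group.IsNilpotent

open Subgroup

variable {G : Type*} [Group G] [Finite G]

/-- A nilpotent subgroup has a Sylow subgroup consisting of all its elements of `q`-power order. -/
theorem exists_sylow_subgroup {J : Subgroup G} (hJ : Group.IsNilpotent J) (q : ℕ) [Fact q.Prime] :
    ∃ Q : Subgroup G, Q ≤ J ∧ IsPGroup q Q ∧ ¬ q ∣ Q.relIndex J ∧
      ∀ j ∈ J, (∃ n : ℕ, j ^ q ^ n = 1) → j ∈ Q := by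
  let S : Sylow q J := default
  have hS := Sylow.unique_of_normal S inferInstance
  refine ⟨(S : Subgroup J).map J.subtype, map_subtype_le _, S.isPGroup'.map _, ?_, ?_⟩
  · rw [relIndex, subgroupOf, comap_map_eq_self_of_injective J.subtype_injective]
    exact S.not_dvd_index
  · rintro j hj ⟨n, hn⟩
    have hz : IsPGroup q (zpowers (⟨j, hj⟩ : J)) := by
      refine IsPGroup.of_card_dvd_pow (n := n) ?_
      rw [Nat.card_zpowers]
      exact orderOf_dvd_of_pow_eq_one (Subtype.ext hn)
    obtain ⟨T, hT⟩ := hz.exists_le_sylow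
    have : T = S := Subsingleton.elim _ _
    exact ⟨⟨j, hj⟩, this ▸ hT (mem_zpowers _), rfl⟩

/-- A prime dividing the order of a nilpotent group divides the order of some generator. -/
theorem exists_dvd_orderOf [hG : Group.IsNilpotent G] {D : Set G} (hD : closure D = ⊤) {r : ℕ}
    (hr : r.Prime) (h : r ∣ Nat.card G) : ∃ x ∈ D, r ∣ orderOf x := by
  have : Fact r.Prime := ⟨hr⟩
  let e := Sylow.directProductOfNormal (G := G) fun P => inferInstance
  let P : Sylow r G := default
  have hmem : r ∈ (Nat.card G).primeFactors := Nat.mem_primeFactors.2 ⟨hr, h, Nat.card_pos.ne'⟩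
  let π : G →* P := ((Pi.evalMonoidHom (fun P : Sylow r G => (P : Subgroup G)) P).comp
    (Pi.evalMonoidHom (fun p : (Nat.card G).primeFactors => ∀ P : Sylow p G, (P : Subgroup G))
      ⟨r, hmem⟩)).comp e.symm.toMonoidHom
  have hπ : Function.Surjective π := by
    intro t
    obtain ⟨f, hf⟩ := Function.surjective_eval (β := fun P : Sylow r G => (P : Subgroup G)) P t
    obtain ⟨f', hf'⟩ := Function.surjective_eval
      (β := fun p : (Nat.card G).primeFactors => ∀ P : Sylow p G, (P : Subgroup G))
      ⟨r, hmem⟩ f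
    refine ⟨e f', ?_⟩
    have hπe : π (e f') = (e.symm (e f') ⟨r, hmem⟩ : ∀ P : Sylow r G, (P : Subgroup G)) P := rfl
    rw [hπe, e.symm_apply_apply, ← hf, ← hf']
  by_contra! hc
  have hle : closure D ≤ π.ker := by
    rw [closure_le]
    intro x hx
    by_contra hne
    exact hc x hx ((P.isPGroup'.dvd_orderOf hne).trans (orderOf_map_dvd π x))
  have := (nontrivial_iff_ne_bot _).2 (P.ne_bot_of_dvd_card h)
  obtain ⟨⟨t, ht⟩, hne⟩ := exists_ne (1 : P)
  obtain ⟨g, hg⟩ := hπ ⟨t, ht⟩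
  exact hne (hg.symm.trans (hle (hD ▸ mem_top g)))

end Group.IsNilpotent

/-! ### Tuples that agree modulo a normal q'-subgroup -/

namespace Subgroup

variable {G : Type*} [Group G]

theorem map_closure_range_conj {ι : Type*} {U : Subgroup G} [U.Normal] {x w : ι → G}
    (hw : ∀ i, w i ∈ U) :
    (closure (Set.range fun i => w i * x i * (w i)⁻¹)).map (QuotientGroup.mk' U) =
      (closure (Set.range x)).map (QuotientGroup.mk' U) := by
  rw [MonoidHom.map_closure, MonoidHom.map_closure, ← Set.range_comp, ← Set.range_comp]
  congr 2
  funext i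
  have := (QuotientGroup.eq_one_iff (w i)).2 (hw i)
  simp [this]

variable [Finite G]

theorem relIndex_sup_dvd_card (J U : Subgroup G) [U.Normal] : J.relIndex (J ⊔ U) ∣ Nat.card U := by
  have h := card_sup_dvd J U
  rw [← relIndex_bot_left, ← relIndex_mul_relIndex ⊥ J (J ⊔ U) bot_le le_sup_left,
    relIndex_bot_left] at h
  exact Nat.dvd_of_mul_dvd_mul_left Nat.card_pos h

/-- If a normal `q'`-subgroup `U` makes two nilpotent subgroups equal modulo `U`, then their Sylow
`q`-subgroups are conjugate by an element of `U`. -/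
theorem exists_conj_sylow_subgroup {J₀ J₁ U Q₀ Q₁ : Subgroup G} [U.Normal] {q : ℕ} [Fact q.Prime]
    (hU : ¬ q ∣ Nat.card U) (hJ : J₀ ⊔ U = J₁ ⊔ U) (hQJ₀ : Q₀ ≤ J₀) (hQJ₁ : Q₁ ≤ J₁)
    (hQ₀ : IsPGroup q Q₀) (hQ₁ : IsPGroup q Q₁) (hi₀ : ¬ q ∣ Q₀.relIndex J₀)
    (hi₁ : ¬ q ∣ Q₁.relIndex J₁) (hn : ∀ j ∈ J₀, ∀ t ∈ Q₀, j * t * j⁻¹ ∈ Q₀) :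
    ∃ v ∈ U, Q₁ = Q₀.map (MulAut.conj v).toMonoidHom := by
  have hq : q.Prime := Fact.out
  have key : ∀ {J Q : Subgroup G}, Q ≤ J → ¬ q ∣ Q.relIndex J → ¬ q ∣ Q.relIndex (J ⊔ U) := by
    intro J Q hQJ hQ hdvd
    rw [← relIndex_mul_relIndex Q J (J ⊔ U) hQJ le_sup_left, hq.dvd_mul] at hdvd
    exact hdvd.elim hQ fun h => hU (h.trans (relIndex_sup_dvd_card J U))
  have h1 := key hQJ₁ hi₁
  rw [← hJ] at h1
  -- Since U is a q'-group, Q₀ and Q₁ are both Sylow in J₀ ⊔ U. The conjugating element factors as v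
  -- * a with a ∈ J₀ normalising Q₀, so v alone suffices.
  let S₀ : Sylow q (J₀ ⊔ U : Subgroup G) :=
    IsPGroup.toSylow (P := Q₀.subgroupOf (J₀ ⊔ U)) hQ₀.comap_subtype (key hQJ₀ hi₀)
  let S₁ : Sylow q (J₀ ⊔ U : Subgroup G) :=
    IsPGroup.toSylow (P := Q₁.subgroupOf (J₀ ⊔ U)) hQ₁.comap_subtype h1
  have hQ₁le : Q₁ ≤ J₀ ⊔ U := hQJ₁.trans (hJ ▸ le_sup_left)
  have hQ₀le : Q₀ ≤ J₀ ⊔ U := hQJ₀.trans le_sup_left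
  obtain ⟨⟨j, hj⟩, hS⟩ := MulAction.exists_smul_eq (J₀ ⊔ U : Subgroup G) S₀ S₁
  obtain ⟨v, hv, a, ha, rfl⟩ := mem_sup_of_normal_left.1 (sup_comm J₀ U ▸ hj : j ∈ U ⊔ J₀)
  refine ⟨v, hv, ?_⟩
  have hcard : Nat.card Q₁ = Nat.card Q₀ := by
    have : Nat.card (Q₁.subgroupOf (J₀ ⊔ U)) = Nat.card (Q₀.subgroupOf (J₀ ⊔ U)) :=
      Nat.card_congr (Sylow.equiv S₁ S₀).toEquiv
    rwa [Nat.card_congr (subgroupOfEquivOfLe hQ₁le).toEquiv,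
      Nat.card_congr (subgroupOfEquivOfLe hQ₀le).toEquiv] at this
  refine (eq_of_le_of_card_ge ?_ ?_).symm
  · rintro _ ⟨t, ht, rfl⟩
    have ht' : a⁻¹ * t * a ∈ Q₀ := by simpa using hn a⁻¹ (inv_mem ha) t ht
    have : (⟨v * a, hj⟩ * ⟨a⁻¹ * t * a, hQ₀le ht'⟩ * ⟨v * a, hj⟩⁻¹ : (J₀ ⊔ U : Subgroup G)) ∈
        ((⟨v * a, hj⟩ : (J₀ ⊔ U : Subgroup G)) • S₀ : Sylow q _) := ⟨_, ht', rfl⟩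
    rw [hS] at this
    have h2 : v * a * (a⁻¹ * t * a) * (v * a)⁻¹ ∈ Q₁ := this
    simpa [mul_assoc] using h2
  · rw [card_map_of_injective (MulAut.conj v).injective, hcard]

/-- If the tuples `x` and `w x w⁻¹` with `w` in a normal `q'`-subgroup `U` generate subgroups with
nilpotent `k`-th term of the lower Fitting series, and `U` contains no nontrivial fixed points of
the `q`-part of that term, then the tuples are conjugate by a single element of `U`. -/
theorem exists_conj_eq_conj {ι : Type*} {U : Subgroup G} [U.Normal] {q : ℕ} [Fact q.Prime]
    (hU : ¬ q ∣ Nat.card U) {x w : ι → G} (hw : ∀ i, w i ∈ U) {k : ℕ}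
    (h₀ : (closure (Set.range x)).lowerFittingSeries (k + 1) = ⊥)
    (h₁ : (closure (Set.range fun i => w i * x i * (w i)⁻¹)).lowerFittingSeries (k + 1) = ⊥)
    (hfix : ∀ u ∈ U, (∀ j ∈ (closure (Set.range x)).lowerFittingSeries k,
      (∃ n : ℕ, j ^ q ^ n = 1) → j * u = u * j) → u = 1) :
    ∃ v ∈ U, ∀ i, w i * x i * (w i)⁻¹ = v * x i * v⁻¹ := by
  set H₀ := closure (Set.range x)
  set H₁ := closure (Set.range fun i => w i * x i * (w i)⁻¹)
  have hJ : H₀.lowerFittingSeries k ⊔ U = H₁.lowerFittingSeries k ⊔ U := by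
    have : (H₀.lowerFittingSeries k).map (QuotientGroup.mk' U) =
        (H₁.lowerFittingSeries k).map (QuotientGroup.mk' U) := by
      rw [map_lowerFittingSeries, map_lowerFittingSeries, map_closure_range_conj hw]
    have := congrArg (comap (QuotientGroup.mk' U)) this
    simpa [comap_map_eq] using this
  obtain ⟨Q₀, hQJ₀, hQ₀, hi₀, hm₀⟩ :=
    ((nilpotentResidual_eq_bot_iff _).1 h₀).exists_sylow_subgroup q
  obtain ⟨Q₁, hQJ₁, hQ₁, hi₁, hm₁⟩ :=
    ((nilpotentResidual_eq_bot_iff _).1 h₁).exists_sylow_subgroup q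
  have hpow : ∀ {Q : Subgroup G}, IsPGroup q Q → ∀ t ∈ Q, ∀ g : G,
      ∃ n : ℕ, (g * t * g⁻¹) ^ q ^ n = 1 := by
    intro Q hQ t ht g
    obtain ⟨n, hn⟩ := hQ ⟨t, ht⟩
    refine ⟨n, ?_⟩
    have : t ^ q ^ n = 1 := congrArg Subtype.val hn
    rw [conj_pow, this]; group
  have hnorm₀ : ∀ g ∈ H₀, ∀ t ∈ Q₀, g * t * g⁻¹ ∈ Q₀ := fun g hg t ht =>
    hm₀ _ (conj_mem_lowerFittingSeries hg (hQJ₀ ht)) (hpow hQ₀ t ht g)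
  have hnorm₁ : ∀ g ∈ H₁, ∀ t ∈ Q₁, g * t * g⁻¹ ∈ Q₁ := fun g hg t ht =>
    hm₁ _ (conj_mem_lowerFittingSeries hg (hQJ₁ ht)) (hpow hQ₁ t ht g)
  obtain ⟨v, hv, hQ⟩ := exists_conj_sylow_subgroup hU hJ hQJ₀ hQJ₁ hQ₀ hQ₁ hi₀ hi₁
    fun j hj => hnorm₀ j (lowerFittingSeries_le _ _ hj)
  have hmem : ∀ t, t ∈ Q₀ ↔ v * t * v⁻¹ ∈ Q₁ := by
    intro t
    rw [hQ]
    exact (mem_map_iff_mem (f := (MulAut.conj v).toMonoidHom) (MulAut.conj v).injective).symm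
  have hdisj : ∀ t ∈ Q₀, t ∈ U → t = 1 := by
    intro t ht htU
    obtain ⟨n, hn⟩ := hQ₀ ⟨t, ht⟩
    have h1 : orderOf t ∣ q ^ n := orderOf_dvd_of_pow_eq_one (congrArg Subtype.val hn)
    have h2 : orderOf t ∣ Nat.card U := orderOf_dvd_natCard U htU
    have h3 : Nat.Coprime (q ^ n) (Nat.card U) :=
      Nat.Coprime.pow_left n (((Fact.out : q.Prime).coprime_iff_not_dvd).2 hU)
    exact orderOf_eq_one_iff.1 (Nat.eq_one_of_dvd_coprimes h3 h1 h2)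
  refine ⟨v, hv, fun i => ?_⟩
  set y := w i * x i * (w i)⁻¹ with hy
  have hyH : y ∈ H₁ := subset_closure ⟨i, rfl⟩
  have hxH : x i ∈ H₀ := subset_closure ⟨i, rfl⟩
  have hUn : U.Normal := inferInstance
  -- This element c measures the failure of v to conjugate x i to y. It lies in U and normalises Q₀,
  -- so its commutators with Q₀ lie in Q₀ ∩ U = 1; then c = 1 by `hfix`.
  have hcU : v⁻¹ * y * v * (x i)⁻¹ ∈ U := by
    have : (QuotientGroup.mk' U) (v⁻¹ * y * v * (x i)⁻¹) = 1 := by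
      have h1 := (QuotientGroup.eq_one_iff v).2 hv
      have h2 := (QuotientGroup.eq_one_iff (w i)).2 (hw i)
      simp [hy, h1, h2]
    rwa [QuotientGroup.mk'_apply, QuotientGroup.eq_one_iff] at this
  have hcN : ∀ t ∈ Q₀, (v⁻¹ * y * v * (x i)⁻¹) * t * (v⁻¹ * y * v * (x i)⁻¹)⁻¹ ∈ Q₀ := by
    intro t ht
    have h1 := hnorm₀ (x i)⁻¹ (inv_mem hxH) t ht
    have h2 := hnorm₁ y hyH _ ((hmem _).1 h1)
    rw [hmem]
    simpa [mul_assoc] using h2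
  have hc1 : v⁻¹ * y * v * (x i)⁻¹ = 1 := by
    refine hfix _ hcU fun j hj hjn => ?_
    have hjQ := hm₀ j hj hjn
    have h1 : ⁅v⁻¹ * y * v * (x i)⁻¹, j⁆ = 1 := by
      refine hdisj _ ?_ ?_
      · exact Q₀.mul_mem (hcN j hjQ) (Q₀.inv_mem hjQ)
      · rw [commutatorElement_def, mul_assoc, mul_assoc, ← mul_assoc j]
        exact U.mul_mem hcU (hUn.conj_mem _ (U.inv_mem hcU) j)
    exact (commutatorElement_eq_one_iff_mul_comm.1 h1).symm
  rw [mul_inv_eq_one, mul_assoc, inv_mul_eq_iff_eq_mul, ← eq_mul_inv_iff_mul_eq] at hc1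
  exact hc1

end Subgroup

/-- A suitable power of j has q-power order and the same image. This lifts q-elements of
automorphism groups back to q-elements of the k-th term. -/
theorem MonoidHom.exists_mem_pow_eq_one {G G' : Type*} [Group G] [Group G'] [Finite G] (f : G →* G')
    {q : ℕ} (hq : q.Prime) (J : Subgroup G) {j : G} (hj : j ∈ J) {n : ℕ} (h : f j ^ q ^ n = 1) :
    ∃ i ∈ J, (∃ m : ℕ, i ^ q ^ m = 1) ∧ f i = f j := by
  obtain ⟨a, b, hb, hab⟩ := Nat.exists_eq_pow_mul_and_not_dvd (orderOf_pos j).ne' q hq.ne_one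
  have hcop : Nat.Coprime b (orderOf (f j)) := by
    refine Nat.Coprime.coprime_dvd_right (orderOf_dvd_of_pow_eq_one h) ?_
    exact Nat.Coprime.pow_right n ((hq.coprime_iff_not_dvd.2 hb).symm)
  obtain ⟨c, hc⟩ := exists_pow_eq_self_of_coprime hcop
  refine ⟨(j ^ b) ^ c, J.pow_mem (J.pow_mem hj b) c, ⟨a, ?_⟩, by rw [map_pow, map_pow, hc]⟩
  rw [← pow_mul, ← pow_mul, show b * (c * q ^ a) = q ^ a * b * c by ring, pow_mul, ← hab,
    pow_orderOf_eq_one, one_pow]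

/-! ### Irreducible submodules under coprime action -/

section Module

variable {R V : Type*} [Group R] [CommGroup V] [MulDistribMulAction R V] [Finite V]

/-- If a finite normal subgroup `Q` of order coprime to `|V|` acts nontrivially on `V`, then there is
an irreducible submodule of `V` without nontrivial `Q`-fixed points. -/
theorem exists_irreducible_submodule (Q : Subgroup R) [hQ : Q.Normal] [Finite Q]
    (hcop : (Nat.card V).Coprime (Nat.card Q)) (hnt : ∃ t ∈ Q, ∃ v : V, t • v ≠ v) :
    ∃ U : Subgroup V, U ≠ ⊥ ∧ (∀ g : R, ∀ u ∈ U, g • u ∈ U) ∧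
      (∀ U' ≤ U, (∀ g : R, ∀ u ∈ U', g • u ∈ U') → U' = ⊥ ∨ U' = U) ∧
      ∀ u ∈ U, (∀ t ∈ Q, t • u = u) → u = 1 := by
  classical
  have : Fintype Q := Fintype.ofFinite Q
  -- The norm map of Q. Its values are Q-fixed, so it is not onto and its kernel is nontrivial. On
  -- Q-fixed points it is the |Q|-th power, injective by coprimality, so the kernel has no
  -- nontrivial ones.
  let ν : V →* V :=
    { toFun := fun v => ∏ t : Q, t • v
      map_one' := by simp
      map_mul' := fun a b => by simp [Finset.prod_mul_distrib] }
  have hν : ∀ v, ν v = ∏ t : Q, t • v := fun v => rfl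
  have hνQ : ∀ v, ∀ t ∈ Q, t • ν v = ν v := by
    intro v t ht
    rw [hν, Finset.smul_prod']
    refine Fintype.prod_equiv (Equiv.mulLeft ⟨t, ht⟩) _ _ fun s => ?_
    exact (mul_smul t (s : R) v).symm
  have hνR : ∀ (g : R) v, ν (g • v) = g • ν v := by
    intro g v
    rw [hν, hν, Finset.smul_prod']
    refine (Fintype.prod_equiv (MulAut.conjNormal g : MulAut Q).toEquiv _ _ fun s => ?_).symm
    change g • (s : R) • v = ((MulAut.conjNormal g s : Q) : R) • g • v
    rw [MulAut.conjNormal_apply, ← mul_smul, ← mul_smul, inv_mul_cancel_right]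
  have hfix : ∀ u ∈ ν.ker, (∀ t ∈ Q, t • u = u) → u = 1 := by
    intro u hu hut
    have h1 : u ^ Nat.card Q = 1 := by
      have h : ν u = ∏ _t : Q, u := Finset.prod_congr rfl fun t _ => hut t t.2
      rw [MonoidHom.mem_ker, h] at hu
      simpa using hu
    have h2 := Nat.dvd_gcd (orderOf_dvd_natCard u) (orderOf_dvd_of_pow_eq_one h1)
    rw [hcop] at h2
    exact orderOf_eq_one_iff.1 (Nat.dvd_one.1 h2)
  have hker : ν.ker ≠ ⊥ := by
    intro hbot
    have hsurj := Finite.surjective_of_injective ((MonoidHom.ker_eq_bot_iff ν).1 hbot)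
    obtain ⟨t, ht, v, hv⟩ := hnt
    obtain ⟨w, rfl⟩ := hsurj v
    exact hv (hνQ w t ht)
  obtain ⟨U, hUle, ⟨hU0, hUR⟩, hmin⟩ := exists_minimal_le_of_wellFoundedLT
    (fun U : Subgroup V => U ≠ ⊥ ∧ ∀ g : R, ∀ u ∈ U, g • u ∈ U) ν.ker
    ⟨hker, fun g u hu => by rw [MonoidHom.mem_ker, hνR, MonoidHom.mem_ker.1 hu, smul_one]⟩
  refine ⟨U, hU0, hUR, fun U' hU' hinv => ?_, fun u hu => hfix u (hUle hu)⟩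
  by_cases h : U' = ⊥
  · exact Or.inl h
  · exact Or.inr (le_antisymm hU' (hmin ⟨h, hinv⟩ hU'))

/-- The bound on the number of fixed points, for an irreducible submodule. -/
theorem card_inf_fixedSubgroup_pow_four_le [Group.IsSolvable R] {U : Subgroup V}
    (hU : ∀ g : R, ∀ u ∈ U, g • u ∈ U)
    (hirr : ∀ U' ≤ U, (∀ g : R, ∀ u ∈ U', g • u ∈ U') → U' = ⊥ ∨ U' = U)
    (hnt : ∃ g : R, ∃ u ∈ U, g • u ≠ u) {x : R} (hx : normalClosure {x} = ⊤) :
    Nat.card (U ⊓ fixedSubgroup V {x} : Subgroup V) ^ 4 ≤ Nat.card U ^ 3 := by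
  let act : MulDistribMulAction R U :=
    { smul := fun g u => ⟨g • (u : V), hU g u u.2⟩
      one_smul := fun u => Subtype.ext (one_smul R (u : V))
      mul_smul := fun g h u => Subtype.ext (mul_smul g h (u : V))
      smul_mul := fun g u v => Subtype.ext (smul_mul' g (u : V) v)
      smul_one := fun g => Subtype.ext (smul_one g) }
  have hact : ∀ (g : R) (u : U), ((g • u : U) : V) = g • (u : V) := fun g u => rfl
  have hcard : Nat.card (U ⊓ fixedSubgroup V {x} : Subgroup V) =
      Nat.card (fixedSubgroup U {x}) := by
    have : (fixedSubgroup U {x}).map U.subtype = U ⊓ fixedSubgroup V {x} := by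
      ext v
      simp only [mem_map, mem_inf, mem_fixedSubgroup_singleton]
      constructor
      · rintro ⟨u, hu, rfl⟩
        exact ⟨u.2, congrArg Subtype.val hu⟩
      · rintro ⟨hv, hxv⟩
        exact ⟨⟨v, hv⟩, Subtype.ext hxv, rfl⟩
    rw [← this, card_map_of_injective U.subtype_injective]
  rw [hcard]
  refine card_fixedSubgroup_pow_four_le (fun U' hU' => ?_) ?_ hx
  · refine (hirr (U'.map U.subtype) (map_subtype_le U') ?_).imp (fun h => ?_) fun h => ?_
    · rintro g _ ⟨u, hu, rfl⟩
      exact ⟨g • u, hU' g u hu, rfl⟩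
    · exact (map_eq_bot_iff_of_injective _ U.subtype_injective).1 h
    · refine map_injective U.subtype_injective (h.trans ?_)
      rw [← MonoidHom.range_eq_map, range_subtype]
  · obtain ⟨g, u, hu, hgu⟩ := hnt
    exact ⟨g, ⟨u, hu⟩, fun h => hgu (congrArg Subtype.val h)⟩

end Module

/-! ### Five generators suffice for a given prime -/

/-- Every finite solvable group with lower Fitting series of length at most `k + 1`, generated by a
conjugation-invariant set `D`, has for each prime `r` dividing the order of the `k`-th term a subgroup
generated by five elements of `D` with the same property. -/
def FiveGeneratorProperty.{u} (k : ℕ) : Prop :=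
  ∀ (G : Type u) [Group G] [Finite G] [Group.IsSolvable G] (D : Set G),
    (∀ a ∈ D, ∀ g, g * a * g⁻¹ ∈ D) → closure D = ⊤ →
    (⊤ : Subgroup G).lowerFittingSeries (k + 1) = ⊥ →
    ∀ r : ℕ, r.Prime → r ∣ Nat.card ((⊤ : Subgroup G).lowerFittingSeries k) →
    ∃ d : Fin 5 → G, (∀ i, d i ∈ D) ∧
      r ∣ Nat.card ((closure (Set.range d)).lowerFittingSeries k)

theorem fiveGeneratorProperty_zero : FiveGeneratorProperty 0 := by
  intro G _ _ _ D hD hcl hbot r hr hdvd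
  have : Group.IsNilpotent G :=
    Group.isNilpotent_top.1 ((nilpotentResidual_eq_bot_iff _).1 hbot)
  rw [lowerFittingSeries_zero, card_top] at hdvd
  obtain ⟨x, hx, hrx⟩ := Group.IsNilpotent.exists_dvd_orderOf hcl hr hdvd
  refine ⟨fun _ => x, fun _ => hx, hrx.trans ?_⟩
  exact orderOf_dvd_natCard (closure (Set.range fun _ : Fin 5 => x)) (subset_closure ⟨0, rfl⟩)

theorem closure_range_comp_subtype {G : Type*} [Group G] {R : Subgroup G} {ι : Type*} (d : ι → R) :
    (closure (Set.range d)).map R.subtype = closure (Set.range fun i => (d i : G)) := by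
  rw [MonoidHom.map_closure, ← Set.range_comp]
  rfl

/-- The five generators can be chosen so that the subgroup which they generate is the normal closure of
each of them. -/
theorem FiveGeneratorProperty.exists_subgroup.{u} {k : ℕ} (hk : FiveGeneratorProperty.{u} k)
    {A : Type u} [Group A] [Finite A] {L : Subgroup A} [hL : Group.IsSolvable L] {D : Set A}
    (hD : ∀ a ∈ D, ∀ g ∈ L, g * a * g⁻¹ ∈ D) (hcl : closure D = L)
    (hbot : L.lowerFittingSeries (k + 1) = ⊥) {q : ℕ} (hq : q.Prime)
    (hdvd : q ∣ Nat.card (L.lowerFittingSeries k)) :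
    ∃ R ≤ L, ∃ d : Fin 5 → R, (∀ i, (d i : A) ∈ D) ∧ closure (Set.range d) = ⊤ ∧
      q ∣ Nat.card (R.lowerFittingSeries k) ∧ ∀ i, normalClosure {d i} = ⊤ := by
  have hcard : ∀ {R : Subgroup A} (X : Subgroup R), Nat.card (X.lowerFittingSeries k) =
      Nat.card ((X.map R.subtype).lowerFittingSeries k) := by
    intro R X
    rw [← map_lowerFittingSeries, card_map_of_injective R.subtype_injective]
  -- Minimality is used twice: R is the normal closure of one x ∈ D, and is generated by any five of
  -- its R-conjugates of x that keep q in the k-th term. Being conjugates of x in R, these have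
  -- normal closure R as well.
  obtain ⟨R, hRL, ⟨hR, hRq⟩, hmin⟩ := exists_minimal_le_of_wellFoundedLT
    (fun R : Subgroup A => closure (D ∩ R) = R ∧ q ∣ Nat.card (R.lowerFittingSeries k)) L
    ⟨by
      rw [Set.inter_eq_left.2, hcl]
      exact hcl ▸ subset_closure, hdvd⟩
  have hmin' : ∀ X : Subgroup R, closure (D ∩ X.map R.subtype) = X.map R.subtype →
      q ∣ Nat.card (X.lowerFittingSeries k) → X = ⊤ := by
    intro X h1 h2
    rw [hcard] at h2
    have := hmin ⟨h1, h2⟩ (map_subtype_le X)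
    rw [eq_top_iff]
    intro y _
    obtain ⟨z, hz, hzy⟩ := this y.2
    exact Subtype.ext hzy ▸ hz
  have hDR : closure {y : R | (y : A) ∈ D} = ⊤ := by
    refine map_injective R.subtype_injective ?_
    rw [MonoidHom.map_closure, ← MonoidHom.range_eq_map, range_subtype]
    refine Eq.trans (congrArg Subgroup.closure ?_) hR
    ext y
    exact ⟨fun ⟨z, hz, hzy⟩ => hzy ▸ ⟨hz, z.2⟩, fun ⟨hy, hyR⟩ => ⟨⟨y, hyR⟩, hy, rfl⟩⟩
  obtain ⟨x, hxD, hx⟩ := exists_dvd_card_lowerFittingSeries_normalClosure (G := R) hDR hq (k := k) (by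
    rwa [hcard, ← MonoidHom.range_eq_map, range_subtype])
  have hconjD : ∀ y ∈ Group.conjugatesOfSet {x}, (y : A) ∈ D := by
    intro y hy
    obtain ⟨z, hz, hzy⟩ := Group.mem_conjugatesOfSet_iff.1 hy
    obtain ⟨g, rfl⟩ := isConj_iff.1 (Set.mem_singleton_iff.1 hz ▸ hzy : IsConj x y)
    exact hD x hxD g (hRL g.2)
  have hgen : ∀ S : Set R, (∀ y ∈ S, (y : A) ∈ D) →
      closure (D ∩ (closure S).map R.subtype) = (closure S).map R.subtype := by
    intro S hS
    refine le_antisymm ((closure_le _).2 Set.inter_subset_right) ?_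
    rw [MonoidHom.map_closure]
    refine closure_mono ?_
    rintro _ ⟨y, hy, rfl⟩
    exact ⟨hS y hy, subset_closure ⟨y, hy, rfl⟩⟩
  have hxtop : normalClosure {x} = ⊤ := hmin' _ (hgen _ hconjD) hx
  have hRsol : Group.IsSolvable R :=
    Group.isSolvable_of_isSolvable_injective (inclusion_injective hRL)
  have hRbot : (⊤ : Subgroup R).lowerFittingSeries (k + 1) = ⊥ := by
    refine map_injective R.subtype_injective ?_
    rw [map_subtype_lowerFittingSeries_top, Subgroup.map_bot, eq_bot_iff, ← hbot]
    exact lowerFittingSeries_mono hRL _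
  obtain ⟨d, hd, hdq⟩ := hk R (Group.conjugatesOfSet {x})
    (fun a ha g => Group.conj_mem_conjugatesOfSet ha) hxtop hRbot q hq
    (by rwa [hcard, ← MonoidHom.range_eq_map, range_subtype])
  refine ⟨R, hRL, d, fun i => hconjD _ (hd i), ?_, hRq, fun i => ?_⟩
  · refine hmin' _ (hgen _ ?_) hdq
    rintro _ ⟨i, rfl⟩
    exact hconjD _ (hd i)
  · rw [eq_top_iff, ← hxtop]
    refine normalClosure_le_normal (Set.singleton_subset_iff.2 ?_)
    obtain ⟨y, hy, hxy⟩ := Group.mem_conjugatesOfSet_iff.1 (hd i)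
    obtain ⟨g, hg⟩ := isConj_iff.1 (Set.mem_singleton_iff.1 hy ▸ hxy : IsConj x (d i))
    have h1 : g⁻¹ * d i * g⁻¹⁻¹ = x := by rw [← hg]; group
    have h2 : d i ∈ normalClosure {d i} := subset_normalClosure (Set.mem_singleton _)
    have h3 := (inferInstance : (normalClosure {d i}).Normal).conj_mem (d i) h2 g⁻¹
    rw [h1] at h3
    exact h3

/-- Combines coprime action with the fixed-point bound; R acts nontrivially on U because Q has no
nontrivial fixed points there. -/
theorem exists_submodule_of_le_mulAut {V : Type*} [CommGroup V] [Finite V] {R Q : Subgroup (MulAut V)}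
    [Group.IsSolvable R] (hQR : Q ≤ R) (hn : ∀ g ∈ R, ∀ t ∈ Q, g * t * g⁻¹ ∈ Q)
    (hcop : (Nat.card V).Coprime (Nat.card Q)) (hQ : Q ≠ ⊥) :
    ∃ U : Subgroup V, U ≠ ⊥ ∧ (∀ g ∈ R, ∀ u ∈ U, g u ∈ U) ∧
      (∀ u ∈ U, (∀ t ∈ Q, t u = u) → u = 1) ∧
      ∀ d : R, normalClosure {d} = ⊤ →
        Nat.card {u : V // u ∈ U ∧ (d : MulAut V) u = u} ^ 4 ≤ Nat.card U ^ 3 := by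
  have hQn : (Q.subgroupOf R).Normal := ⟨fun t ht g => hn g g.2 t ht⟩
  have hcard : Nat.card (Q.subgroupOf R) = Nat.card Q :=
    Nat.card_congr (subgroupOfEquivOfLe hQR).toEquiv
  obtain ⟨t, htQ, ht1⟩ := Q.bot_or_exists_ne_one.resolve_left hQ
  obtain ⟨v, hv⟩ : ∃ v, t v ≠ v := by
    by_contra! h
    exact ht1 (MulEquiv.ext h)
  obtain ⟨U, hU0, hUR, hirr, hfix⟩ := exists_irreducible_submodule (V := V) (Q.subgroupOf R)
    (hcard ▸ hcop) ⟨⟨t, hQR htQ⟩, htQ, v, hv⟩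
  have hfix' : ∀ u ∈ U, (∀ t ∈ Q, t u = u) → u = 1 := fun u hu h =>
    hfix u hu fun s hs => h s hs
  refine ⟨U, hU0, fun g hg u hu => hUR ⟨g, hg⟩ u hu, hfix', fun d hd => ?_⟩
  have hnt : ∃ g : R, ∃ u ∈ U, g • u ≠ u := by
    obtain ⟨u, hu, hu1⟩ := U.bot_or_exists_ne_one.resolve_left hU0
    by_contra! h
    exact hu1 (hfix' u hu fun s hs => h ⟨s, hQR hs⟩ u hu)
  refine le_of_eq_of_le ?_ (card_inf_fixedSubgroup_pow_four_le hUR hirr hnt hd)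
  congr 1
  refine Nat.card_congr (Equiv.subtypeEquivRight fun u => ?_)
  rw [mem_inf, mem_fixedSubgroup_singleton]
  rfl

/-- If all tuples of conjugates of `x i` by elements of `U` are conjugate by a single element of `U`
and each `x i` centralises at most `|U|^(3/4)` elements of `U`, then `U` is trivial. -/
theorem eq_bot_of_forall_exists_conj_eq_conj {G : Type*} [Group G] [Finite G] {U : Subgroup G}
    {x : Fin 5 → G} (h : ∀ w : Fin 5 → G, (∀ i, w i ∈ U) →
      ∃ v ∈ U, ∀ i, w i * x i * (w i)⁻¹ = v * x i * v⁻¹)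
    (hb : ∀ i, Nat.card {u : G // u ∈ U ∧ x i * u = u * x i} ^ 4 ≤ Nat.card U ^ 3) : U = ⊥ := by
  choose v hv hconj using fun w : Fin 5 → U => h (fun i => w i) fun i => (w i).2
  -- If v conjugates x to the same tuple as w does, each v⁻¹ * w i centralises x i; these elements
  -- and v recover w.
  let f : (Fin 5 → U) → U × ∀ i, {u : G // u ∈ U ∧ x i * u = u * x i} := fun w =>
    (⟨v w, hv w⟩, fun i => ⟨(v w)⁻¹ * w i, U.mul_mem (U.inv_mem (hv w)) (w i).2, by
      have := hconj w i
      rw [mul_inv_eq_iff_eq_mul] at this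
      rw [mul_assoc, this]
      group⟩)
  have hf : Function.Injective f := by
    intro w w' hww
    have h1 : v w = v w' := congrArg (fun y => (y.1 : G)) hww
    funext i
    have h2 : (v w)⁻¹ * w i = (v w')⁻¹ * w' i := congrArg (fun y => (y.2 i : G)) hww
    rw [h1] at h2
    exact Subtype.ext (mul_left_cancel h2)
  have hcard := Nat.card_le_card_of_injective f hf
  rw [Nat.card_prod, Nat.card_pi, Nat.card_pi, Finset.prod_const, Finset.card_univ,
    Fintype.card_fin] at hcard
  have hpos : 0 < Nat.card U := Nat.card_pos
  have h2 : (∏ i, Nat.card {u : G // u ∈ U ∧ x i * u = u * x i}) ^ 4 ≤ (Nat.card U ^ 3) ^ 5 := by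
    rw [← Finset.prod_pow]
    exact (Finset.prod_le_prod' fun i _ => hb i).trans_eq (by simp)
  -- Five is the least n with n > 1 + 3n/4; the powers 20 and 19 are both sides multiplied by 4.
  have h3 : Nat.card U ^ 20 ≤ Nat.card U ^ 19 :=
    calc Nat.card U ^ 20 = (Nat.card U ^ 5) ^ 4 := by ring
      _ ≤ (Nat.card U * ∏ i, Nat.card {u : G // u ∈ U ∧ x i * u = u * x i}) ^ 4 :=
        Nat.pow_le_pow_left hcard 4
      _ ≤ Nat.card U ^ 4 * (Nat.card U ^ 3) ^ 5 := by
        rw [mul_pow]; exact Nat.mul_le_mul_left _ h2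
      _ = Nat.card U ^ 19 := by ring
  refine eq_bot_of_card_le U ?_
  by_contra! hlt
  exact absurd h3 (Nat.pow_lt_pow_right hlt (by norm_num)).not_ge

/-- The core of the induction step: some choice of conjugates generates a subgroup whose lower Fitting
series does not vanish one step further. -/
theorem exists_lowerFittingSeries_conj_ne_bot {G : Type*} [Group G] [Finite G] [Group.IsSolvable G]
    {V : Subgroup G} [V.Normal] (hcomm : ∀ a b : V, a * b = b * a) {r q : ℕ} [Fact r.Prime]
    [Fact q.Prime] (hrq : r ≠ q) (hV : IsPGroup r V) {k : ℕ} {x : Fin 5 → G}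
    {R : Subgroup (MulAut V)} (d : Fin 5 → R) (hd : ∀ i, (d i : MulAut V) = MulAut.conjNormal (x i))
    (hdR : closure (Set.range d) = ⊤) (hq : q ∣ Nat.card (R.lowerFittingSeries k))
    (hncl : ∀ i, normalClosure {d i} = ⊤) :
    ∃ w : Fin 5 → G,
      (closure (Set.range fun i => w i * x i * (w i)⁻¹)).lowerFittingSeries (k + 1) ≠ ⊥ := by
  by_contra! hbot
  have hRx : (closure (Set.range x)).map (MulAut.conjNormal : G →* MulAut V) = R := by
    rw [MonoidHom.map_closure, ← Set.range_comp, ← R.range_subtype, MonoidHom.range_eq_map, ← hdR,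
      closure_range_comp_subtype]
    congr 2
    funext i
    exact (hd i).symm
  have hbot₀ : (closure (Set.range x)).lowerFittingSeries (k + 1) = ⊥ := by
    simpa using hbot fun _ => 1
  have hRsol : Group.IsSolvable R := by
    rw [← hRx]
    exact Group.isSolvable_of_surjective
      ((MulAut.conjNormal : G →* MulAut V).subgroupMap_surjective (closure (Set.range x)))
  have hJ : Group.IsNilpotent (R.lowerFittingSeries k) := by
    rw [← nilpotentResidual_eq_bot_iff, ← lowerFittingSeries_succ, ← hRx, ← map_lowerFittingSeries,
      hbot₀, Subgroup.map_bot]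
  obtain ⟨Q, hQJ, hQ, hi, hm⟩ := hJ.exists_sylow_subgroup q
  have hQR : Q ≤ R := hQJ.trans (lowerFittingSeries_le _ _)
  have hQ0 : Q ≠ ⊥ := by
    rintro rfl
    rw [relIndex_bot_left] at hi
    exact hi hq
  have hpow : ∀ t ∈ Q, ∃ n : ℕ, t ^ q ^ n = 1 := fun t ht => by
    obtain ⟨n, hn⟩ := hQ ⟨t, ht⟩
    exact ⟨n, congrArg Subtype.val hn⟩
  have hQn : ∀ g ∈ R, ∀ t ∈ Q, g * t * g⁻¹ ∈ Q := by
    intro g hg t ht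
    refine hm _ (conj_mem_lowerFittingSeries hg (hQJ ht)) ?_
    obtain ⟨n, hn⟩ := hpow t ht
    exact ⟨n, by rw [conj_pow, hn]; group⟩
  have hVq : ¬ q ∣ Nat.card V := by
    intro h
    obtain ⟨n, hn⟩ := IsPGroup.iff_card.1 hV
    rw [hn] at h
    exact hrq ((Nat.prime_dvd_prime_iff_eq Fact.out Fact.out).1
      ((Fact.out : q.Prime).dvd_of_dvd_pow h)).symm
  have hcop : (Nat.card V).Coprime (Nat.card Q) := by
    obtain ⟨n, hn⟩ := IsPGroup.iff_card.1 hQ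
    rw [hn]
    exact Nat.Coprime.pow_right n (((Fact.out : q.Prime).coprime_iff_not_dvd.2 hVq).symm)
  obtain ⟨U, hU0, hUR, hfix, hbound⟩ := @exists_submodule_of_le_mulAut V
    { (inferInstance : Group V) with mul_comm := hcomm } _ R Q hRsol hQR hQn hcop hQ0
  let U' : Subgroup G := U.map V.subtype
  have hxU : ∀ i, x i ∈ normalizer (U' : Set G) := by
    refine fun i => mem_normalizer_fintype ?_
    rintro _ ⟨u, hu, rfl⟩
    exact ⟨_, hUR _ (d i).2 u hu, by rw [hd, coe_subtype, MulAut.conjNormal_apply]⟩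
  -- U need not be normal in G, but it is normal in its normaliser, which contains every x i because
  -- d i preserves U.
  let Y : Subgroup G := normalizer (U' : Set G)
  have hUY : U' ≤ Y := le_normalizer
  let y : Fin 5 → Y := fun i => ⟨x i, hxU i⟩
  have hUn : (U'.subgroupOf Y).Normal := inferInstance
  have hcardY : Nat.card (U'.subgroupOf Y) = Nat.card U := by
    rw [Nat.card_congr (subgroupOfEquivOfLe hUY).toEquiv]
    exact card_map_of_injective V.subtype_injective
  have hUq : ¬ q ∣ Nat.card (U'.subgroupOf Y) := by
    rw [hcardY]
    exact fun h => hVq (h.trans (card_subgroup_dvd_card U))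
  have hfixY : ∀ u ∈ U'.subgroupOf Y, (∀ j ∈ (closure (Set.range y)).lowerFittingSeries k,
      (∃ n : ℕ, j ^ q ^ n = 1) → j * u = u * j) → u = 1 := by
    rintro ⟨_, hY⟩ ⟨u, hu, rfl⟩ hj
    have : u = 1 := by
      refine hfix u hu fun t ht => ?_
      obtain ⟨n, hn⟩ := hpow t ht
      have htJ := hQJ ht
      rw [← hRx, ← map_lowerFittingSeries, ← closure_range_comp_subtype y, ← map_lowerFittingSeries]
        at htJ
      obtain ⟨_, ⟨j, hjJ, rfl⟩, rfl⟩ := htJ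
      obtain ⟨i, hiJ, hin, hij⟩ := ((MulAut.conjNormal : G →* MulAut V).comp
        Y.subtype).exists_mem_pow_eq_one (Fact.out : q.Prime) _ hjJ hn
      have h1 := congrArg Subtype.val (hj i hiJ hin)
      have h2 : (MulAut.conjNormal (i : G) : MulAut V) u = u := by
        apply Subtype.ext
        rw [MulAut.conjNormal_apply, mul_inv_eq_iff_eq_mul]
        exact h1
      exact (DFunLike.congr_fun hij u).symm.trans h2
    subst this
    rfl
  have hUbot : U'.subgroupOf Y = ⊥ := by
    refine eq_bot_of_forall_exists_conj_eq_conj (x := y) (fun w hw => ?_) fun i => ?_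
    · have hres : ∀ z : Fin 5 → Y, (closure (Set.range fun i => (z i : G))).lowerFittingSeries (k + 1)
          = ⊥ → (closure (Set.range z)).lowerFittingSeries (k + 1) = ⊥ := by
        intro z hz
        rw [← closure_range_comp_subtype, ← map_lowerFittingSeries] at hz
        exact (map_eq_bot_iff_of_injective _ Y.subtype_injective).1 hz
      exact exists_conj_eq_conj hUq hw (hres y hbot₀) (hres _ (hbot fun i => w i)) hfixY
    · rw [hcardY]
      refine le_trans (Nat.pow_le_pow_left ?_ 4) (hbound (d i) (hncl i))
      let f : {u : Y // u ∈ U'.subgroupOf Y ∧ y i * u = u * y i} →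
          {u : V // u ∈ U ∧ (d i : MulAut V) u = u} := fun u =>
        ⟨⟨u.1, (map_subtype_le U) u.2.1⟩, by
          obtain ⟨v, hv, hvu⟩ := u.2.1
          exact (Subtype.ext hvu : v = ⟨u.1, (map_subtype_le U) u.2.1⟩) ▸ hv, by
          apply Subtype.ext
          rw [hd, MulAut.conjNormal_apply, mul_inv_eq_iff_eq_mul]
          exact congrArg Subtype.val u.2.2⟩
      refine Nat.card_le_card_of_injective f fun a b hab => ?_
      exact Subtype.ext (Subtype.ext (congrArg (fun z => ((z.1 : V) : G)) hab))
  refine hU0 (card_eq_one.1 ?_)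
  rw [← hcardY, hUbot, card_bot]

theorem IsPGroup.of_forall_prime_dvd_eq {G : Type*} [Group G] [Finite G] {r : ℕ}
    (h : ∀ p : ℕ, p.Prime → p ∣ Nat.card G → p = r) : IsPGroup r G :=
  IsPGroup.of_card (Nat.eq_prime_pow_of_unique_prime_dvd Nat.card_pos.ne' fun hp hd => h _ hp hd)

theorem Subgroup.card_map_mul_card_ker_inf {G G' : Type*} [Group G] [Group G'] (f : G →* G')
    (N : Subgroup G) : Nat.card (N.map f) * Nat.card (f.ker ⊓ N : Subgroup G) = Nat.card N := by
  rw [← relIndex_ker, ← inf_relIndex_right, ← relIndex_bot_left, ← relIndex_bot_left, mul_comm]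
  exact relIndex_mul_relIndex _ _ _ bot_le inf_le_right

/-- If a nilpotent normal subgroup `N` has order divisible by `r`, but its image in each proper quotient
has order prime to `r`, then `N` is a minimal normal `r`-subgroup. -/
theorem isPGroup_and_le_of_forall_not_dvd {G : Type*} [Group G] [Finite G] {N : Subgroup G}
    [hN : N.Normal] (hnil : Group.IsNilpotent N) {r : ℕ} (hr : r.Prime) (hdvd : r ∣ Nat.card N)
    (h : ∀ (X : Subgroup G) [X.Normal], X ≠ ⊥ → ¬ r ∣ Nat.card (N.map (QuotientGroup.mk' X))) :
    IsPGroup r N ∧ ∀ (X : Subgroup G) [X.Normal], X ≠ ⊥ → N ≤ X := by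
  have hp : IsPGroup r N := by
    refine IsPGroup.of_forall_prime_dvd_eq fun p hp hpN => ?_
    by_contra hpr
    have : Fact p.Prime := ⟨hp⟩
    obtain ⟨S, hSN, hS, hi, hm⟩ := hnil.exists_sylow_subgroup p
    have hSn : S.Normal := by
      refine ⟨fun t ht g => hm _ (hN.conj_mem t (hSN ht) g) ?_⟩
      obtain ⟨n, hn⟩ := hS ⟨t, ht⟩
      refine ⟨n, ?_⟩
      have : t ^ p ^ n = 1 := congrArg Subtype.val hn
      rw [conj_pow, this]
      group
    have hS0 : S ≠ ⊥ := by
      rintro rfl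
      rw [relIndex_bot_left] at hi
      exact hi hpN
    refine h S hS0 ?_
    have hcard := card_map_mul_card_ker_inf (QuotientGroup.mk' S) N
    rw [QuotientGroup.ker_mk', inf_eq_left.2 hSN] at hcard
    rw [← hcard, hr.dvd_mul] at hdvd
    refine hdvd.resolve_right fun hrS => ?_
    obtain ⟨n, hn⟩ := IsPGroup.iff_card.1 hS
    rw [hn] at hrS
    exact hpr ((Nat.prime_dvd_prime_iff_eq hr hp).1 (hr.dvd_of_dvd_pow hrS)).symm
  refine ⟨hp, fun X _ hX => ?_⟩
  have : Fact r.Prime := ⟨hr⟩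
  obtain ⟨n, hn⟩ := IsPGroup.iff_card.1 (hp.map (QuotientGroup.mk' X))
  have h1 := h X hX
  rw [hn] at h1
  have hn0 : n = 0 := by
    by_contra hn0
    exact h1 (dvd_pow_self r hn0)
  rw [hn0, pow_zero, card_eq_one, Subgroup.map_eq_bot_iff, QuotientGroup.ker_mk'] at hn
  exact hn

/-- A counterexample of least order has N minimal normal. The inductive hypothesis is applied to the
action on N at a prime other than r, which is why the property must allow a prescribed prime. -/
theorem FiveGeneratorProperty.succ.{u} {k : ℕ} (hk : FiveGeneratorProperty.{u} k) :
    FiveGeneratorProperty.{u} (k + 1) := by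
  intro G
  induction hc : Nat.card G using Nat.strong_induction_on generalizing G with
  | _ n ih =>
  intro _ _ _ D hD hcl hbot r hr hdvd
  subst hc
  have : Fact r.Prime := ⟨hr⟩
  by_contra! hcon
  set N := (⊤ : Subgroup G).lowerFittingSeries (k + 1) with hNdef
  set K := (⊤ : Subgroup G).lowerFittingSeries k with hKdef
  have hN : N.Normal := inferInstance
  have hK : K.Normal := inferInstance
  have hmapTop : ∀ (X : Subgroup G) [X.Normal], (⊤ : Subgroup G).map (QuotientGroup.mk' X) = ⊤ :=
    fun X _ => map_top_of_surjective _ (QuotientGroup.mk'_surjective X)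
  -- Five generators found in a proper quotient would lift to G.
  have hquot : ∀ (X : Subgroup G) [X.Normal], X ≠ ⊥ →
      ¬ r ∣ Nat.card (N.map (QuotientGroup.mk' X)) := by
    intro X _ hX hdX
    have hlt : Nat.card (G ⧸ X) < Nat.card G := by
      rw [card_eq_card_quotient_mul_card_subgroup X]
      exact lt_mul_of_one_lt_right Nat.card_pos (X.one_lt_card_iff_ne_bot.2 hX)
    rw [hNdef, map_lowerFittingSeries, hmapTop] at hdX
    have hD' : ∀ a ∈ QuotientGroup.mk' X '' D, ∀ g, g * a * g⁻¹ ∈ QuotientGroup.mk' X '' D := by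
      rintro _ ⟨a, ha, rfl⟩ g
      obtain ⟨g, rfl⟩ := QuotientGroup.mk'_surjective X g
      exact ⟨g * a * g⁻¹, hD a ha g, by simp⟩
    have hcl' : closure (QuotientGroup.mk' X '' D) = ⊤ := by
      rw [← MonoidHom.map_closure, hcl, hmapTop]
    have hbot' : (⊤ : Subgroup (G ⧸ X)).lowerFittingSeries (k + 1 + 1) = ⊥ := by
      rw [← hmapTop, ← map_lowerFittingSeries, hbot, Subgroup.map_bot]
    obtain ⟨d, hd, hdr⟩ := ih _ hlt (G ⧸ X) rfl _ hD' hcl' hbot' r hr hdX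
    choose e he hed using hd
    refine hcon e he (hdr.trans ?_)
    have : closure (Set.range d) = (closure (Set.range e)).map (QuotientGroup.mk' X) := by
      rw [MonoidHom.map_closure, ← Set.range_comp]
      exact congrArg (fun d => Subgroup.closure (Set.range d)) (funext fun i => (hed i).symm)
    rw [this, ← map_lowerFittingSeries]
    exact card_map_dvd _ _
  have hN0 : N ≠ ⊥ := fun h => by
    rw [h, card_bot] at hdvd
    exact hr.not_dvd_one hdvd
  obtain ⟨hNr, hNmin⟩ := isPGroup_and_le_of_forall_not_dvd
    ((nilpotentResidual_eq_bot_iff N).1 hbot) hr hdvd hquot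
  have hNcomm : ⁅N, N⁆ = ⊥ := by
    by_contra hne
    exact (Group.IsSolvable.commutator_lt_of_ne_bot hN0).not_ge (hNmin _ hne)
  have hcomm : ∀ a b : N, a * b = b * a := fun a b => by
    have : ⁅(a : G), (b : G)⁆ = 1 := by
      rw [← mem_bot, ← hNcomm]
      exact commutator_mem_commutator a.2 b.2
    exact Subtype.ext (commutatorElement_eq_one_iff_mul_comm.1 this)
  let ρ : G →* MulAut N := MulAut.conjNormal
  have hrange : (⊤ : Subgroup G).map ρ = ρ.range := (MonoidHom.range_eq_map ρ).symm
  -- If K acted on N as an r-group it would have a nontrivial fixed point, and minimality of N would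
  -- give [N, K] = 1. But N is the nilpotent residual of K, so [N, K] = N.
  obtain ⟨q, hq, hqK, hqr⟩ : ∃ q : ℕ, q.Prime ∧ q ∣ Nat.card (K.map ρ) ∧ q ≠ r := by
    by_contra! hall
    have hKr : IsPGroup r (K.map ρ) := IsPGroup.of_forall_prime_dvd_eq hall
    obtain ⟨v, hv, hv1⟩ := hKr.exists_fixed_point_of_prime_dvd_card_of_fixed_point N hdvd
      (a := (1 : N)) (fun g => smul_one g)
    have hX : (v : G) ∈ N ⊓ centralizer (K : Set G) := by
      refine ⟨v.2, mem_centralizer_iff.2 fun g hg => ?_⟩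
      have h1 : ρ g v = v := hv ⟨ρ g, g, hg, rfl⟩
      have h2 := congrArg Subtype.val h1
      rwa [MulAut.conjNormal_apply, mul_inv_eq_iff_eq_mul] at h2
    have hX0 : N ⊓ centralizer (K : Set G) ≠ ⊥ := by
      intro h
      rw [h, mem_bot] at hX
      exact hv1 (Subtype.ext hX).symm
    have hle : N ≤ centralizer (K : Set G) := (hNmin _ hX0).trans inf_le_right
    rw [← commutator_eq_bot_iff_le_centralizer] at hle
    exact hN0 ((commutator_nilpotentResidual K).symm.trans hle)
  have : Fact q.Prime := ⟨hq⟩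
  -- N acts trivially on itself, so the image of G has lower Fitting series one step shorter.
  have hρN : N.map ρ = ⊥ := by
    rw [Subgroup.map_eq_bot_iff]
    intro a ha
    refine MulEquiv.ext fun b => Subtype.ext ?_
    rw [MulAut.conjNormal_apply, mul_inv_eq_iff_eq_mul]
    exact congrArg Subtype.val (hcomm ⟨a, ha⟩ b)
  obtain ⟨R, hRle, d, hd, hdR, hqR, hncl⟩ := hk.exists_subgroup (L := ρ.range) (D := ρ '' D)
    (hL := Group.isSolvable_of_surjective ρ.rangeRestrict_surjective)
    (by
      rintro _ ⟨a, ha, rfl⟩ _ ⟨g, rfl⟩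
      exact ⟨g * a * g⁻¹, hD a ha g, by simp⟩)
    (by rw [← MonoidHom.map_closure, hcl, hrange])
    (by rw [← hrange, ← map_lowerFittingSeries, hρN]) hq
    (by rwa [← hrange, ← map_lowerFittingSeries])
  choose x hx hxd using hd
  obtain ⟨w, hw⟩ := exists_lowerFittingSeries_conj_ne_bot hcomm hqr.symm hNr d
    (fun i => (hxd i).symm) hdR hqR hncl
  refine hcon (fun i => w i * x i * (w i)⁻¹) (fun i => hD _ (hx i) _) ?_
  have hle := lowerFittingSeries_mono
    (le_top (a := closure (Set.range fun i => w i * x i * (w i)⁻¹))) (k + 1)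
  have := (hNr.to_le hle).card_eq_or_dvd
  exact this.resolve_left fun h => hw (card_eq_one.1 h)

theorem fiveGeneratorProperty.{u} (k : ℕ) : FiveGeneratorProperty.{u} k := by
  induction k with
  | zero => exact fiveGeneratorProperty_zero
  | succ k ih => exact ih.succ

/-! ### From five generators to ten conjugates -/

/-- Elements of order `r` of a finite nilpotent subgroup generate an `r`-group. -/
theorem Subgroup.isPGroup_closure_of_isNilpotent {G : Type*} [Group G] [Finite G] {T : Subgroup G}
    (hT : Group.IsNilpotent T) {r : ℕ} [Fact r.Prime] {S : Set G} (hS : S ⊆ T)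
    (hr : ∀ s ∈ S, s ^ r = 1) : IsPGroup r (closure S) := by
  obtain ⟨Q, -, hQ, -, hm⟩ := hT.exists_sylow_subgroup r
  exact hQ.to_le ((closure_le _).2 fun s hs => hm s (hS hs) ⟨1, by rw [pow_one, hr s hs]⟩)

/-- If any ten conjugates of `x ≠ 1` generate a solvable subgroup, then the group has a nontrivial
normal `r`-subgroup for some prime `r`. -/
theorem exists_normal_isPGroup_of_ten_conjugates {G : Type*} [Group G] [Finite G] {x : G}
    (hx : x ≠ 1)
    (h : ∀ c : Fin 10 → G, (∀ i, IsConj x (c i)) → Group.IsSolvable (closure (Set.range c))) :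
    ∃ r : ℕ, r.Prime ∧ ∃ M : Subgroup G, M.Normal ∧ M ≠ ⊥ ∧ IsPGroup r M := by
  classical
  have hconj : ∀ (a : G), IsConj x a → ∀ g, IsConj x (g * a * g⁻¹) := fun a ha g =>
    ha.trans (isConj_iff.2 ⟨g, rfl⟩)
  have hex : ∃ m, ∀ c : Fin 10 → G, (∀ i, IsConj x (c i)) →
      (closure (Set.range c)).lowerFittingSeries m = ⊥ := by
    have : ∀ c : Fin 10 → G, ∃ m, (∀ i, IsConj x (c i)) →
        (closure (Set.range c)).lowerFittingSeries m = ⊥ := fun c => by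
      by_cases hc : ∀ i, IsConj x (c i)
      · have := h c hc
        obtain ⟨m, hm⟩ := exists_lowerFittingSeries_eq_bot (closure (Set.range c))
        exact ⟨m, fun _ => hm⟩
      · exact ⟨0, fun h => absurd h hc⟩
    choose m hm using this
    obtain ⟨B, hB⟩ := (Set.finite_range m).bddAbove
    refine ⟨B, fun c hc => le_bot_iff.1 ?_⟩
    rw [← hm c hc]
    exact lowerFittingSeries_antitone _ (hB ⟨c, rfl⟩)
  -- The largest lower Fitting length over all ten-tuples; it is positive since x ≠ 1.
  obtain ⟨k, hk⟩ : ∃ k, Nat.find hex = k + 1 := by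
    refine Nat.exists_eq_succ_of_ne_zero fun h0 => hx ?_
    have h1 := Nat.find_spec hex (fun _ => x) fun _ => IsConj.refl x
    rw [h0, lowerFittingSeries_zero, closure_eq_bot_iff] at h1
    exact h1 ⟨0, rfl⟩
  have hbot := Nat.find_spec hex
  rw [hk] at hbot
  have hnot := Nat.find_min hex (m := k) (by omega)
  push Not at hnot
  obtain ⟨c, hc, hck⟩ := hnot
  obtain ⟨r, hr, hrc⟩ := Nat.exists_prime_and_dvd fun h1 => hck (card_eq_one.1 h1)
  have : Fact r.Prime := ⟨hr⟩
  have hsol := h c hc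
  set L := closure (Set.range c)
  have hDcl : closure {a : L | IsConj x (a : G)} = ⊤ := by
    refine map_injective L.subtype_injective ?_
    rw [← MonoidHom.range_eq_map, range_subtype]
    refine le_antisymm (map_subtype_le _) ((closure_le _).2 ?_)
    rintro _ ⟨i, rfl⟩
    exact ⟨⟨c i, subset_closure ⟨i, rfl⟩⟩, subset_closure (hc i), rfl⟩
  have hLbot : (⊤ : Subgroup L).lowerFittingSeries (k + 1) = ⊥ := by
    refine map_injective L.subtype_injective ?_
    rw [map_subtype_lowerFittingSeries_top, Subgroup.map_bot]
    exact hbot c hc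
  have hcardL : ∀ X : Subgroup L, Nat.card (X.lowerFittingSeries k) =
      Nat.card ((X.map L.subtype).lowerFittingSeries k) := by
    intro X
    rw [← map_lowerFittingSeries, card_map_of_injective L.subtype_injective]
  obtain ⟨d, hd, hdr⟩ := fiveGeneratorProperty k L {a : L | IsConj x (a : G)}
    (fun a ha g => hconj a ha g) hDcl hLbot r hr (by
      rwa [hcardL, ← MonoidHom.range_eq_map, range_subtype])
  rw [hcardL, closure_range_comp_subtype] at hdr
  obtain ⟨⟨y, hy⟩, hyr⟩ := exists_prime_orderOf_dvd_card' r hdr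
  rw [orderOf_mk] at hyr
  -- Ten is twice five: the d i and their g-conjugates form a ten-tuple, whose k-th term is
  -- nilpotent by the choice of k.
  have hpair : ∀ g : G, ∃ T : Subgroup G, Group.IsNilpotent T ∧ y ∈ T ∧ g * y * g⁻¹ ∈ T := by
    intro g
    let e : Fin 10 → G := Fin.append (m := 5) (n := 5) (fun i => (d i : G))
      fun i => g * (d i : G) * g⁻¹
    have he : ∀ i, IsConj x (e i) := by
      intro i
      refine Fin.addCases (m := 5) (n := 5) (fun j => ?_) (fun j => ?_) i
      · have : e (Fin.castAdd 5 j) = d j := Fin.append_left _ _ j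
        exact this ▸ hd j
      · have : e (Fin.natAdd 5 j) = g * (d j : G) * g⁻¹ := Fin.append_right _ _ j
        exact this ▸ hconj _ (hd j) g
    refine ⟨(closure (Set.range e)).lowerFittingSeries k,
      (nilpotentResidual_eq_bot_iff _).1 (hbot e he), lowerFittingSeries_mono ?_ k hy, ?_⟩
    · refine closure_mono ?_
      rintro _ ⟨i, rfl⟩
      exact ⟨Fin.castAdd 5 i, Fin.append_left _ _ i⟩
    · have h1 : (MulAut.conj g).toMonoidHom y ∈
          ((closure (Set.range fun i => (d i : G))).map (MulAut.conj g).toMonoidHom).lowerFittingSeries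
            k := by
        rw [← map_lowerFittingSeries]
        exact ⟨y, hy, rfl⟩
      refine lowerFittingSeries_mono ?_ k h1
      rw [MonoidHom.map_closure]
      refine closure_mono ?_
      rintro _ ⟨_, ⟨i, rfl⟩, rfl⟩
      exact ⟨Fin.natAdd 5 i, Fin.append_right _ _ i⟩
  refine ⟨r, hr, normalClosure {y}, inferInstance, ?_, ?_⟩
  · intro h0
    have hy1 : y = 1 := by
      rw [← mem_bot, ← h0]
      exact subset_normalClosure (Set.mem_singleton y)
    rw [hy1, orderOf_one] at hyr
    exact hr.one_lt.ne hyr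
  · refine IsPGroup.closure_of_closure_pair (fun a ha g => Group.conj_mem_conjugatesOfSet ha) ?_
    intro a ha b hb
    have hmem : ∀ a ∈ Group.conjugatesOfSet {y}, ∃ g, g * y * g⁻¹ = a := by
      intro a ha
      obtain ⟨z, hz, hza⟩ := Group.mem_conjugatesOfSet_iff.1 ha
      exact isConj_iff.1 (Set.mem_singleton_iff.1 hz ▸ hza : IsConj y a)
    obtain ⟨s, rfl⟩ := hmem a ha
    obtain ⟨t, rfl⟩ := hmem b hb
    obtain ⟨T, hT, hyT, hgT⟩ := hpair (s⁻¹ * t)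
    have hpow : y ^ r = 1 := hyr ▸ pow_orderOf_eq_one y
    have hp := isPGroup_closure_of_isNilpotent hT (r := r) (S := {y, s⁻¹ * t * y * (s⁻¹ * t)⁻¹})
      (by rintro _ (rfl | rfl) <;> assumption) (by
        rintro _ (rfl | rfl)
        · exact hpow
        · rw [conj_pow, hpow]; group)
    have := hp.map (MulAut.conj s).toMonoidHom
    have h1 : (MulAut.conj s).toMonoidHom y = s * y * s⁻¹ := rfl
    have h2 : (MulAut.conj s).toMonoidHom (s⁻¹ * t * y * (s⁻¹ * t)⁻¹) = t * y * t⁻¹ := by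
      change s * (s⁻¹ * t * y * (s⁻¹ * t)⁻¹) * s⁻¹ = _
      group
    rw [MonoidHom.map_closure, Set.image_pair, h1, h2] at this
    exact this

/-- If any ten conjugates of `x` generate a solvable subgroup, then all conjugates do. -/
theorem isSolvable_normalClosure_of_ten_conjugates {G : Type*} [Group G] [Finite G] {x : G}
    (h : ∀ c : Fin 10 → G, (∀ i, IsConj x (c i)) → Group.IsSolvable (closure (Set.range c))) :
    Group.IsSolvable (normalClosure {x}) := by
  induction hn : Nat.card G using Nat.strong_induction_on generalizing G with
  | _ n ih =>
  subst hn
  by_cases hx : x = 1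
  · have : normalClosure {x} = ⊥ := normalClosure_eq_bot_iff.2 (by simp [hx])
    rw [this]
    infer_instance
  obtain ⟨r, hr, M, hM, hM0, hMr⟩ := exists_normal_isPGroup_of_ten_conjugates hx h
  have : Fact r.Prime := ⟨hr⟩
  have hMsol : Group.IsSolvable M := by
    have := hMr.isNilpotent
    infer_instance
  let π := QuotientGroup.mk' M
  have hπ : Function.Surjective π := QuotientGroup.mk'_surjective M
  have hlt : Nat.card (G ⧸ M) < Nat.card G := by
    rw [card_eq_card_quotient_mul_card_subgroup M]
    exact lt_mul_of_one_lt_right Nat.card_pos (M.one_lt_card_iff_ne_bot.2 hM0)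
  have hquot : Group.IsSolvable (normalClosure {π x}) := by
    refine ih _ hlt (fun c hc => ?_) rfl
    have hlift : ∀ i, ∃ a, IsConj x a ∧ π a = c i := by
      intro i
      obtain ⟨g, hg⟩ := isConj_iff.1 (hc i)
      obtain ⟨g, rfl⟩ := hπ g
      exact ⟨g * x * g⁻¹, isConj_iff.2 ⟨g, rfl⟩, by rw [← hg]; simp⟩
    choose e he hec using hlift
    have hsol := h e he
    have : closure (Set.range c) = (closure (Set.range e)).map π := by
      rw [MonoidHom.map_closure, ← Set.range_comp]
      exact congrArg (fun d => Subgroup.closure (Set.range d)) (funext fun i => (hec i).symm)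
    rw [this]
    exact Group.isSolvable_of_surjective (π.subgroupMap_surjective _)
  rw [← Set.image_singleton, ← map_normalClosure _ _ hπ] at hquot
  -- The normal closure is an extension of its solvable image by its intersection with M.
  refine @Group.isSolvable_of_ker_le_range _ _ _ _ _ _
    (inclusion (inf_le_left : normalClosure {x} ⊓ M ≤ normalClosure {x}))
    (π.subgroupMap (normalClosure {x})) (fun a ha => ?_)
    (Group.isSolvable_of_isSolvable_injective
      (inclusion_injective (inf_le_right : normalClosure {x} ⊓ M ≤ M))) hquot
  have haM : (a : G) ∈ M := (QuotientGroup.eq_one_iff _).1 (congrArg Subtype.val ha)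
  exact ⟨⟨a, a.2, haM⟩, rfl⟩

theorem lemmat3 {G : Type*} [Group G] [Finite G] (C : ConjClasses G)
    (hC : ∀ x : Fin 10 → G, (∀ i, x i ∈ C.carrier) →
      Group.IsSolvable (Subgroup.closure (Set.range x))) :
    Group.IsSolvable (Subgroup.closure C.carrier) := by
  obtain ⟨x, rfl⟩ := ConjClasses.exists_rep C
  have hcar : ∀ a, a ∈ (ConjClasses.mk x).carrier ↔ IsConj x a := fun a => by
    rw [ConjClasses.mem_carrier_iff_mk_eq, ConjClasses.mk_eq_mk_iff_isConj, isConj_comm]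
  have := isSolvable_normalClosure_of_ten_conjugates (x := x) fun c hc =>
    hC c fun i => (hcar _).2 (hc i)
  refine Group.isSolvable_of_isSolvable_injective (inclusion_injective
    (show closure (ConjClasses.mk x).carrier ≤ normalClosure {x} from closure_mono fun a ha => ?_))
  exact Group.mem_conjugatesOfSet_iff.2 ⟨x, rfl, (hcar a).1 ha⟩
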